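/- Let $p:\mathbb R\times\mathbb R\to\mathbb R$ be a translation invariant jump density, $p(x,y)=p(0,y-x)$, where $p(0,\cdot)\ge 0$ is a $C^\infty$ probability density with $p(0,z)=0$ for $|z|\ge\xi$, for some $\xi>0$; put $p^*(x,y)=p(y,x)$. Let $X_t$ be the Brownian motion on $\mathbb R$ with jumps occurring independently at rate $1$ with law $p$, i.e. under $P_x$, $X_t=x+B_t+\sum_{i=1}^{N_t}Z_i$ with $B$ a standard Brownian motion, $N$ a Poisson process of rate $1$ and $Z_i$ of density $p(0,\cdot)$, all independent. Let $e^{\mathcal Lt}f(x)=E_x[f(X_t)]$, for $f$ bounded and continuous, and let $e^{\mathcal L^*t}$ be defined in the same way with $p^*$ in place of $p$. These are Markov semigroups (the transition laws $P_x(X_t\in\cdot)$ are probability measures, equal to $\delta_x$ at $t=0$; bounded continuous functions are mapped to bounded continuous functions; and the semigroup property holds), with generators $$\mathcal Lf(x)=\tfrac12 f''(x)+\int p(x,y)[f(y)-f(x)]\,dy,\qquad \mathcal L^*f(x)=\tfrac12 f''(x)+\int p^*(x,y)[f(y)-f(x)]\,dy,$$ in the sense that $t^{-1}(e^{\mathcal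 Lt}f(x)-f(x))\to\mathcal Lf(x)$ as $t\downarrow0$ for every $x$ and every $f\in C^2$ that is bounded together with $f'$ and $f''$ (and likewise for $\mathcal L^*$). For $t>0$ they have non-negative integrable kernels $e^{\mathcal Lt}(x,y)$ and $e^{\mathcal L^*t}(x,y)$, which are $C^\infty$ in $(x,y)$ for each $t>0$ and differentiable in $t>0$ for all $x,y$. With $T_t(x,y):=e^te^{\mathcal Lt}(x,y)$ and $T^*_t(y,x):=e^te^{\mathcal L^*t}(y,x)$ one has $T_t(x,y)=T^*_t(y,x)$. For every $x$, the function $(y,t)\mapsto T^*_t(y,x)$ is a classical solution for $t>0$ of $$\frac{\partial}{\partial t}\rho(y,t)=\frac12\frac{\partial^2}{\partial y^2}\rho(y,t)+\int \rho(z,t)\,p(z,y)\,dz\qquad(1)$$ with initial datum $\delta_x$, i.e. $\int T^*_t(y,x)f(y)\,dy\to f(x)$ as $t\downarrow0$ for every bounded continuous $f$: it is the Green function of (1). Finally, for every bounded continuous $\rho_0:\mathbb R\to\mathbb R$ there is a solution $\rho$ of (1) with initial datum $\rho_0$ that is continuous on $\mathbb R\times[0,\infty)$, bounded on $\mathbb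 R\times[0,T]$ for every $T$, and, for $t>0$, $C^2$ in $y$ and differentiable in $t$; and every such solution is given by $$\rho(x,t)=\int T^*_t(x,y)\rho_0(y)\,dy\quad(t>0),\qquad\text{and satisfies}\quad \|\rho(\cdot,t)\|_\infty\le e^t\|\rho_0\|_\infty\quad(t\ge0).$$ -/

import Mathlib

open MeasureTheory ProbabilityTheory Filter Topology
open scoped ContDiff NNReal BoundedContinuousFunction

noncomputable section

namespace JumpBM

/-- `p x y` is the density at `y` of the position after a jump from `x`: a translation invariant
probability density which is smooth and of finite range. -/
structure IsJumpDensity (p : ℝ → ℝ → ℝ) : Prop where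
  translation : ∀ x y, p x y = p 0 (y - x)
  smooth : ContDiff ℝ ∞ (p 0)
  nonneg : ∀ z, 0 ≤ p 0 z
  integral_eq_one : ∫ z, p 0 z = 1
  finite_range : ∃ ξ : ℝ, 0 < ξ ∧ ∀ z, ξ ≤ |z| → p 0 z = 0

/-- The adjoint jump density `p*(x, y) = p(y, x)`. -/
def adj (p : ℝ → ℝ → ℝ) : ℝ → ℝ → ℝ := fun x y => p y x

/-- The law of the displacement `Z` of a single jump. -/
def jumpLaw (p : ℝ → ℝ → ℝ) : Measure ℝ :=
  volume.withDensity (fun z => ENNReal.ofReal (p 0 z))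

/-- The law of `Z₁ + ⋯ + Zₙ`, for independent jumps `Zᵢ`. -/
def jumpSumLaw (p : ℝ → ℝ → ℝ) : ℕ → Measure ℝ
  | 0 => Measure.dirac 0
  | n + 1 => (jumpSumLaw p n).conv (jumpLaw p)

/-- The law of `Z₁ + ⋯ + Z_N` where `N`, the number of jumps in the time interval `[0, t]`, is a
Poisson variable of mean `t` (jumps occur at rate `1`) independent of the `Zᵢ`. -/
def totalJumpLaw (p : ℝ → ℝ → ℝ) (t : ℝ) : Measure ℝ :=
  Measure.sum fun n : ℕ =>
    ENNReal.ofReal (Real.exp (-t) * t ^ n / (n.factorial : ℝ)) • jumpSumLaw p n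

/-- The law `P_x(X_t ∈ dy)`, `t ≥ 0`, of the Brownian motion with jumps
`X_t = x + B_t + (Z₁ + ⋯ + Z_{N_t})`, where `B` is a standard Brownian motion independent of the
jumps. -/
def transitionLaw (p : ℝ → ℝ → ℝ) (t x : ℝ) : Measure ℝ :=
  ((gaussianReal 0 t.toNNReal).conv (totalJumpLaw p t)).map (fun z => x + z)

/-- A Poisson process of rate `1`. -/
structure IsPoissonProcess {Ω : Type*} [MeasurableSpace Ω] (N : ℝ≥0 → Ω → ℕ) (P : Measure Ω) :
    Prop where
  zero : ∀ᵐ w ∂P, N 0 w = 0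
  paths : ∀ᵐ w ∂P, Monotone (fun t => N t w) ∧
    ∀ t, ContinuousWithinAt (fun s => N s w) (Set.Ici t) t
  indepIncrements : HasIndepIncrements (fun t w => (N t w : ℝ)) P
  increments : ∀ s t, s ≤ t → HasLaw (fun w => N t w - N s w) (poissonMeasure (t - s)) P

/-- `X` is a Brownian motion started at `x` with jumps occurring independently at rate `1`, with
density `p`: `X_t = x + B_t + ∑_{i < N_t} Z_i` with `B` a standard Brownian motion, `N` a Poisson
process of rate `1` and `Z_i` of density `p 0`, all independent. -/
structure IsBrownianMotionWithJumps {Ω : Type*} [MeasurableSpace Ω] (p : ℝ → ℝ → ℝ) (x : ℝ)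
    (B : ℝ≥0 → Ω → ℝ) (N : ℝ≥0 → Ω → ℕ) (Z : ℕ → Ω → ℝ) (X : ℝ≥0 → Ω → ℝ) (P : Measure Ω) :
    Prop where
  brownian : IsBrownianReal B P
  poisson : IsPoissonProcess N P
  jumps_law : ∀ i, HasLaw (Z i) (jumpLaw p) P
  jumps_indep : iIndepFun Z P
  indep_poisson_jumps : IndepFun (fun w t => N t w) (fun w i => Z i w) P
  indep_brownian : IndepFun (fun w t => B t w)
    (fun w => ((fun t => N t w : ℝ≥0 → ℕ), (fun i => Z i w : ℕ → ℝ))) P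
  eq : ∀ t w, X t w = x + B t w + ∑ i ∈ Finset.range (N t w), Z i w

/-- The semigroup `f ↦ E_x[f(X_t)]` of the Brownian motion with jumps. -/
def semigroup (p : ℝ → ℝ → ℝ) (t : ℝ) (f : ℝ → ℝ) (x : ℝ) : ℝ :=
  ∫ y, f y ∂(transitionLaw p t x)

/-- The generator `½ f''(x) + ∫ p(x, y) (f(y) - f(x)) dy`. -/
def generator (p : ℝ → ℝ → ℝ) (f : ℝ → ℝ) (x : ℝ) : ℝ :=
  (1 / 2) * iteratedDeriv 2 f x + ∫ y, p x y * (f y - f x)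

/-- The right hand side `½ f''(y) + ∫ f(z) p(z, y) dz` of the free evolution equation. -/
def freeOp (p : ℝ → ℝ → ℝ) (f : ℝ → ℝ) (y : ℝ) : ℝ :=
  (1 / 2) * iteratedDeriv 2 f y + ∫ z, f z * p z y

/-- The probability measures `P t x` are the transition laws of a (Feller) Markov semigroup on
bounded continuous functions, whose generator is given by `A` on the functions of class `C²` that
are bounded together with their first two derivatives. -/
structure IsMarkovSemigroupWithGenerator (P : ℝ → ℝ → Measure ℝ)
    (A : (ℝ → ℝ) → ℝ → ℝ) : Prop where
  isProbabilityMeasure : ∀ t, 0 ≤ t → ∀ x, IsProbabilityMeasure (P t x)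
  zero : ∀ x, P 0 x = Measure.dirac x
  continuous : ∀ t, 0 ≤ t → ∀ f : ℝ →ᵇ ℝ, Continuous fun x => ∫ y, f y ∂(P t x)
  add : ∀ s t, 0 ≤ s → 0 ≤ t → ∀ (f : ℝ →ᵇ ℝ) (x : ℝ),
    ∫ y, f y ∂(P (s + t) x) = ∫ y, (∫ z, f z ∂(P t y)) ∂(P s x)
  generator : ∀ f : ℝ → ℝ, ContDiff ℝ 2 f →
    (∃ C : ℝ, ∀ x, |f x| ≤ C ∧ |deriv f x| ≤ C ∧ |iteratedDeriv 2 f x| ≤ C) →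
    ∀ x, Tendsto (fun t : ℝ => ((∫ y, f y ∂(P t x)) - f x) / t) (𝓝[>] 0) (𝓝 (A f x))

/-- `k t x y` is a kernel of the semigroup for `t > 0`; it is `C^∞` in `(x, y)` and differentiable
in `t`. -/
structure IsSmoothKernel (p : ℝ → ℝ → ℝ) (k : ℝ → ℝ → ℝ → ℝ) : Prop where
  nonneg : ∀ t, 0 < t → ∀ x y, 0 ≤ k t x y
  integrable : ∀ t, 0 < t → ∀ x, Integrable (fun y => k t x y)
  kernel : ∀ t, 0 < t → ∀ (f : ℝ →ᵇ ℝ) (x : ℝ), semigroup p t f x = ∫ y, k t x y * f y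
  smooth : ∀ t, 0 < t → ContDiff ℝ ∞ (fun z : ℝ × ℝ => k t z.1 z.2)
  differentiable_time : ∀ t, 0 < t → ∀ x y, DifferentiableAt ℝ (fun s => k s x y) t

/-- `u t y` is a classical solution, for `t > 0`, of
`∂ₜ u = ½ ∂²u/∂y² + ∫ u(t, z) p(z, y) dz`. -/
structure SolvesFreeEvolution (p : ℝ → ℝ → ℝ) (u : ℝ → ℝ → ℝ) : Prop where
  contDiff : ∀ t, 0 < t → ContDiff ℝ 2 (u t)
  integrable : ∀ t, 0 < t → ∀ y, Integrable (fun z => u t z * p z y)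
  equation : ∀ t, 0 < t → ∀ y, HasDerivAt (fun s => u s y) (freeOp p (u t) y) t

/-- `u` has initial datum `δ_x`: `u(t, y) dy → δ_x` weakly as `t ↓ 0`. -/
def HasInitialDirac (u : ℝ → ℝ → ℝ) (x : ℝ) : Prop :=
  (∀ t, 0 < t → Integrable (u t)) ∧
    ∀ f : ℝ →ᵇ ℝ, Tendsto (fun t => ∫ y, u t y * f y) (𝓝[>] 0) (𝓝 (f x))

/-- `ρ` is the classical solution of the free evolution with initial datum `ρ₀`: continuous up to
`t = 0`, and bounded on bounded time intervals. -/
structure IsSolutionFrom (p : ℝ → ℝ → ℝ) (ρ₀ : ℝ → ℝ) (ρ : ℝ → ℝ → ℝ) : Prop where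
  solves : SolvesFreeEvolution p ρ
  initial : ρ 0 = ρ₀
  continuousOn : ContinuousOn (fun q : ℝ × ℝ => ρ q.1 q.2) (Set.Ici 0 ×ˢ Set.univ)
  bounded : ∀ T : ℝ, ∃ C : ℝ, ∀ t, 0 ≤ t → t ≤ T → ∀ y, |ρ t y| ≤ C

end JumpBM

end

/-! The law of `X_t - x` is the Gaussian of variance `t` convolved with a compound Poisson law.
Integrals against the latter are series with weights `e^{-t} t^n / n!` in the convolution powers
`μ_n` of the jump law, and these series carry nearly everything. Characteristic functions turn the
mixture into `exp(t(φ - 1))`, so both factors are convolution semigroups in `t`, and commutativity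
of convolution gives the Markov semigroup. For the generator, no jump contributes the heat
semigroup, one jump contributes the jump integral, and two or more have probability `O(t²)`.

For the free evolution, the factor `e^t` cancels the Poisson normalisation and leaves `∑ t^n/n! (μ_n
* H_t)`, where `H` solves the heat equation. Differentiating termwise, `H` produces `½ ∂²`, while
differentiating `t^n/n!` shifts the index and so adds one convolution with the jump law, which is
exactly the gain term `∫ ρ(z) p(z, y) dz` (`IsHeatFunction.hasDerivAt_jumpEvolution_time`). Taking
`H` to be the heat kernel gives the Green function; taking its convolution with a bounded datum
gives the solutions.

Replacing `p` by `p*` reverses the sign of each jump. Since the heat kernel is even, this transposes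
the transition density (`IsJumpDensity.jumpKernel_adj`), and it makes `e^t` times the adjoint
semigroup the solution operator.

Uniqueness is a maximum principle with the barrier `m (1 + y²) e^{λt}`
(`SolvesFreeEvolution.nonpos`). It forces every bounded solution to be the explicit one, whose sup
bound holds because transition laws are probability measures. -/

noncomputable section

namespace JumpBM

/-! ### Compound Poisson laws and reversal of the jumps -/

section JumpLaws

variable {p : ℝ → ℝ → ℝ}

lemma IsJumpDensity.continuous (hp : IsJumpDensity p) : Continuous (p 0) := hp.smooth.continuous

/-- The integral of a non-integrable function is `0` by convention, so total integral `1` already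
forces integrability. -/
lemma IsJumpDensity.integrable (hp : IsJumpDensity p) : Integrable (p 0) :=
  by_contra fun h => by simpa [integral_undef h] using hp.integral_eq_one

lemma IsJumpDensity.isProbabilityMeasure_jumpLaw (hp : IsJumpDensity p) :
    IsProbabilityMeasure (jumpLaw p) := by
  refine ⟨?_⟩
  rw [jumpLaw, withDensity_apply _ MeasurableSet.univ, Measure.restrict_univ,
    ← ofReal_integral_eq_lintegral_ofReal hp.integrable (ae_of_all _ hp.nonneg),
    hp.integral_eq_one, ENNReal.ofReal_one]

lemma IsJumpDensity.integral_jumpLaw (hp : IsJumpDensity p) (f : ℝ → ℝ) :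
    ∫ z, f z ∂(jumpLaw p) = ∫ z, p 0 z * f z := by
  rw [jumpLaw, integral_withDensity_eq_integral_toReal_smul
    hp.continuous.measurable.ennreal_ofReal (by simp)]
  simp [ENNReal.toReal_ofReal (hp.nonneg _)]

lemma IsJumpDensity.isProbabilityMeasure_jumpSumLaw (hp : IsJumpDensity p) :
    ∀ n, IsProbabilityMeasure (jumpSumLaw p n)
  | 0 => inferInstanceAs (IsProbabilityMeasure (Measure.dirac 0))
  | n + 1 => by
    have := hp.isProbabilityMeasure_jumpLaw
    have := hp.isProbabilityMeasure_jumpSumLaw n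
    exact inferInstanceAs (IsProbabilityMeasure ((jumpSumLaw p n).conv (jumpLaw p)))

lemma hasSum_poisson_weights (t : ℝ) :
    HasSum (fun n : ℕ => Real.exp (-t) * t ^ n / (n.factorial : ℝ)) 1 := by
  have h := (NormedSpace.expSeries_div_hasSum_exp t).mul_left (Real.exp (-t))
  rw [← Real.exp_eq_exp_ℝ, ← Real.exp_add, neg_add_cancel, Real.exp_zero] at h
  simpa [mul_div_assoc] using h

lemma IsJumpDensity.isProbabilityMeasure_totalJumpLaw (hp : IsJumpDensity p) {t : ℝ}
    (ht : 0 ≤ t) : IsProbabilityMeasure (totalJumpLaw p t) := by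
  refine ⟨?_⟩
  have := hp.isProbabilityMeasure_jumpSumLaw
  rw [totalJumpLaw, Measure.sum_apply _ MeasurableSet.univ]
  simp only [Measure.smul_apply, measure_univ, smul_eq_mul, mul_one]
  rw [← ENNReal.ofReal_tsum_of_nonneg (fun n => by positivity) (hasSum_poisson_weights t).summable,
    (hasSum_poisson_weights t).tsum_eq, ENNReal.ofReal_one]

/-- Conditioning on the number of jumps. General values in `E` are allowed because complex
exponentials are needed as well as real functions. -/
lemma IsJumpDensity.hasSum_integral_totalJumpLaw {E : Type*} [NormedAddCommGroup E]
    [NormedSpace ℝ E] (hp : IsJumpDensity p) {t : ℝ} (ht : 0 ≤ t) {f : ℝ → E}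
    (hf : AEStronglyMeasurable f (totalJumpLaw p t)) {C : ℝ} (hC : ∀ x, ‖f x‖ ≤ C) :
    HasSum (fun n : ℕ => (Real.exp (-t) * t ^ n / (n.factorial : ℝ)) • ∫ z, f z ∂(jumpSumLaw p n))
      (∫ z, f z ∂(totalJumpLaw p t)) := by
  have := hp.isProbabilityMeasure_totalJumpLaw ht
  have h : Integrable f (totalJumpLaw p t) := Integrable.of_bound hf C (ae_of_all _ hC)
  have h2 := hasSum_integral_measure h
  simp only [integral_smul_measure] at h2
  rw [totalJumpLaw]
  convert h2 using 3 with n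
  rw [ENNReal.toReal_ofReal (by positivity)]

lemma IsJumpDensity.charFun_jumpSumLaw (hp : IsJumpDensity p) (n : ℕ) (u : ℝ) :
    charFun (jumpSumLaw p n) u = charFun (jumpLaw p) u ^ n := by
  have := hp.isProbabilityMeasure_jumpLaw
  induction n with
  | zero => simp [jumpSumLaw]
  | succ n ih =>
    have := hp.isProbabilityMeasure_jumpSumLaw n
    rw [jumpSumLaw, charFun_conv, ih, pow_succ]

/-- The Poisson series of the powers `φ^n` is an exponential series. The exponent is linear in `t`,
which yields the convolution semigroup property. -/
lemma IsJumpDensity.charFun_totalJumpLaw (hp : IsJumpDensity p) {t : ℝ} (ht : 0 ≤ t) (u : ℝ) :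
    charFun (totalJumpLaw p t) u = Complex.exp (t * (charFun (jumpLaw p) u - 1)) := by
  have h := hp.hasSum_integral_totalJumpLaw ht (f := fun x : ℝ => Complex.exp (u * x * Complex.I))
    (by fun_prop) (C := 1) (fun x => by
      rw [← Complex.ofReal_mul, Complex.norm_exp_ofReal_mul_I])
  rw [charFun_apply_real]
  refine h.unique ?_
  simp_rw [← charFun_apply_real, hp.charFun_jumpSumLaw]
  have h2 := (NormedSpace.expSeries_div_hasSum_exp ((t : ℂ) * charFun (jumpLaw p) u)).mul_left
    (Complex.exp (-t))
  rw [← Complex.exp_eq_exp_ℂ, ← Complex.exp_add] at h2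
  rw [show (t : ℂ) * (charFun (jumpLaw p) u - 1) = -t + t * charFun (jumpLaw p) u by ring]
  refine h2.congr_fun fun n => ?_
  rw [Complex.real_smul]
  push_cast
  ring

lemma IsJumpDensity.totalJumpLaw_zero (hp : IsJumpDensity p) :
    totalJumpLaw p 0 = Measure.dirac 0 := by
  have := hp.isProbabilityMeasure_totalJumpLaw le_rfl
  refine Measure.ext_of_charFun (funext fun u => ?_)
  rw [hp.charFun_totalJumpLaw le_rfl]
  simp

lemma IsJumpDensity.totalJumpLaw_conv (hp : IsJumpDensity p) {s t : ℝ} (hs : 0 ≤ s)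
    (ht : 0 ≤ t) :
    (totalJumpLaw p s).conv (totalJumpLaw p t) = totalJumpLaw p (s + t) := by
  have := hp.isProbabilityMeasure_totalJumpLaw hs
  have := hp.isProbabilityMeasure_totalJumpLaw ht
  have := hp.isProbabilityMeasure_totalJumpLaw (add_nonneg hs ht)
  refine Measure.ext_of_charFun (funext fun u => ?_)
  rw [charFun_conv, hp.charFun_totalJumpLaw hs, hp.charFun_totalJumpLaw ht,
    hp.charFun_totalJumpLaw (add_nonneg hs ht), ← Complex.exp_add]
  push_cast
  ring_nf

lemma IsJumpDensity.adj_zero (hp : IsJumpDensity p) (z : ℝ) : adj p 0 z = p 0 (-z) := by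
  simp [adj, hp.translation z 0]

lemma IsJumpDensity.adj (hp : IsJumpDensity p) : IsJumpDensity (adj p) where
  translation x y := by
    rw [hp.adj_zero, JumpBM.adj, hp.translation, neg_sub]
  smooth := by
    rw [funext hp.adj_zero]
    exact hp.smooth.comp contDiff_neg
  nonneg z := by rw [hp.adj_zero]; exact hp.nonneg _
  integral_eq_one := by
    simp_rw [hp.adj_zero]
    rw [integral_neg_eq_self (fun z => p 0 z), hp.integral_eq_one]
  finite_range := by
    obtain ⟨ξ, h0, h⟩ := hp.finite_range
    exact ⟨ξ, h0, fun z hz => by rw [hp.adj_zero]; exact h _ (by rwa [abs_neg])⟩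

lemma IsJumpDensity.jumpLaw_adj (hp : IsJumpDensity p) :
    jumpLaw (JumpBM.adj p) = (jumpLaw p).map Neg.neg := by
  refine Measure.ext fun s hs => ?_
  rw [Measure.map_apply measurable_neg hs, jumpLaw, jumpLaw, withDensity_apply _ hs,
    withDensity_apply _ (measurable_neg hs), ← lintegral_indicator hs,
    ← lintegral_indicator (measurable_neg hs),
    ← lintegral_neg_eq_self (fun z => s.indicator _ z)]
  refine lintegral_congr fun z => ?_
  by_cases h : -z ∈ s
  · rw [Set.indicator_of_mem h, Set.indicator_of_mem (by exact h), hp.adj_zero, neg_neg]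
  · rw [Set.indicator_of_notMem h, Set.indicator_of_notMem (by exact h)]

/-- A reversed jump has the opposite displacement, and negation is an additive homomorphism, so it
commutes with convolution. -/
lemma IsJumpDensity.jumpSumLaw_adj (hp : IsJumpDensity p) (n : ℕ) :
    jumpSumLaw (JumpBM.adj p) n = (jumpSumLaw p n).map Neg.neg := by
  have := hp.isProbabilityMeasure_jumpLaw
  induction n with
  | zero => simp [jumpSumLaw, Measure.map_dirac' measurable_neg]
  | succ n ih =>
    have := hp.isProbabilityMeasure_jumpSumLaw n
    rw [jumpSumLaw, jumpSumLaw, ih, hp.jumpLaw_adj]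
    exact (Measure.map_conv_addMonoidHom (negAddMonoidHom : ℝ →+ ℝ) measurable_neg).symm

end JumpLaws

/-! ### The Markov semigroup and its continuity -/

section Semigroup

variable {p : ℝ → ℝ → ℝ}

lemma IsJumpDensity.isProbabilityMeasure_transitionLaw (hp : IsJumpDensity p) {t : ℝ}
    (ht : 0 ≤ t) (x : ℝ) : IsProbabilityMeasure (transitionLaw p t x) := by
  have := hp.isProbabilityMeasure_totalJumpLaw ht
  exact Measure.isProbabilityMeasure_map (by fun_prop)

lemma IsJumpDensity.transitionLaw_zero (hp : IsJumpDensity p) (x : ℝ) :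
    transitionLaw p 0 x = Measure.dirac x := by
  rw [transitionLaw, hp.totalJumpLaw_zero, Real.toNNReal_zero, gaussianReal_zero_var,
    Measure.dirac_conv_dirac, Measure.map_dirac' (by fun_prop)]
  simp

lemma IsJumpDensity.integral_transitionLaw_add (hp : IsJumpDensity p) {s t : ℝ} (hs : 0 ≤ s)
    (ht : 0 ≤ t) (f : ℝ →ᵇ ℝ) (x : ℝ) :
    ∫ y, f y ∂(transitionLaw p (s + t) x) =
      ∫ y, (∫ z, f z ∂(transitionLaw p t y)) ∂(transitionLaw p s x) := by
  have := hp.isProbabilityMeasure_totalJumpLaw hs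
  have := hp.isProbabilityMeasure_totalJumpLaw ht
  -- Both the Gaussian and the jump part are convolution semigroups; commutativity regroups the four
  -- factors by time interval.
  have key : ((gaussianReal 0 (s + t).toNNReal).conv (totalJumpLaw p (s + t))) =
      ((gaussianReal 0 s.toNNReal).conv (totalJumpLaw p s)).conv
        ((gaussianReal 0 t.toNNReal).conv (totalJumpLaw p t)) := by
    rw [← hp.totalJumpLaw_conv hs ht, Real.toNNReal_add hs ht]
    have : gaussianReal 0 (s.toNNReal + t.toNNReal) =
        (gaussianReal 0 s.toNNReal).conv (gaussianReal 0 t.toNNReal) := by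
      rw [gaussianReal_conv_gaussianReal, add_zero]
    rw [this, Measure.conv_assoc, Measure.conv_assoc,
      ← Measure.conv_assoc (gaussianReal 0 t.toNNReal),
      Measure.conv_comm (gaussianReal 0 t.toNNReal), Measure.conv_assoc]
  have hm : ∀ a : ℝ, AEMeasurable (fun z => a + z)
    ((gaussianReal 0 t.toNNReal).conv (totalJumpLaw p t)) := fun a => by fun_prop
  have hi : ∀ (μ : Measure ℝ) [IsFiniteMeasure μ], Integrable (fun z => f (x + z)) μ :=
    fun μ _ => Integrable.of_bound (by fun_prop) ‖f‖ (ae_of_all _ fun z => f.norm_coe_le_norm _)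
  have hin : ∀ y, ∫ z, f z ∂(transitionLaw p t y) =
      ∫ z, f (y + z) ∂((gaussianReal 0 t.toNNReal).conv (totalJumpLaw p t)) := fun y => by
    rw [transitionLaw, integral_map (hm y) (by fun_prop)]
  simp_rw [hin]
  rw [transitionLaw, integral_map (by fun_prop) (by fun_prop), key, integral_conv (hi _),
    transitionLaw, integral_map (by fun_prop)]
  · simp_rw [add_assoc]
  · refine Continuous.aestronglyMeasurable ?_
    refine continuous_of_dominated (bound := fun _ => ‖f‖) (fun y => by fun_prop)
      (fun y => ae_of_all _ fun z => f.norm_coe_le_norm _) (integrable_const _)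
      (ae_of_all _ fun z => by fun_prop)

/-- Brownian scaling puts the time dependence into the integrand over a fixed measure, so that
dominated convergence applies down to `t = 0`. -/
lemma gaussianReal_zero_toNNReal {t : ℝ} (ht : 0 ≤ t) :
    gaussianReal 0 t.toNNReal = (gaussianReal 0 1).map (fun u => √t * u) := by
  rw [gaussianReal_map_const_mul]
  congr 1
  · simp
  · ext
    simp [Real.coe_toNNReal _ ht, Real.sq_sqrt ht]

lemma IsJumpDensity.semigroup_eq_integral_integral (hp : IsJumpDensity p) {t : ℝ} (ht : 0 ≤ t)
    {f : ℝ → ℝ} (hf : Continuous f) {C : ℝ} (hC : ∀ x, |f x| ≤ C) (x : ℝ) :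
    semigroup p t f x =
      ∫ w, (∫ u, f (x + w + √t * u) ∂(gaussianReal 0 1)) ∂(totalJumpLaw p t) := by
  have := hp.isProbabilityMeasure_totalJumpLaw ht
  rw [semigroup, transitionLaw, integral_map (by fun_prop) (by fun_prop), Measure.conv_comm,
    integral_conv (Integrable.of_bound (by fun_prop) C (ae_of_all _ fun z => hC _)),
    gaussianReal_zero_toNNReal ht]
  refine integral_congr_ae (ae_of_all _ fun w => ?_)
  simp only
  rw [integral_map (by fun_prop) (by fun_prop)]
  simp_rw [add_assoc]

/-- The semigroup of Brownian motion: `f ↦ E[f (x + √t U)]` for a standard Gaussian `U`. -/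
def heatSemigroup (t : ℝ) (f : ℝ → ℝ) (x : ℝ) : ℝ := ∫ u, f (x + √t * u) ∂(gaussianReal 0 1)

/-- Since `√` is continuous and is `0` on negative numbers, joint continuity holds on the whole
plane, with no restriction to `t ≥ 0`. -/
lemma continuous_heatSemigroup {f : ℝ → ℝ} (hf : Continuous f) {C : ℝ} (hC : ∀ x, |f x| ≤ C) :
    Continuous fun q : ℝ × ℝ => heatSemigroup q.1 f q.2 :=
  continuous_of_dominated (bound := fun _ => C) (fun q => by fun_prop)
    (fun q => ae_of_all _ fun z => hC _) (integrable_const _) (ae_of_all _ fun z => by fun_prop)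

lemma abs_integral_le_of_bound {μ : Measure ℝ} [IsProbabilityMeasure μ] {f : ℝ → ℝ} {C : ℝ}
    (hC : ∀ x, |f x| ≤ C) : |∫ x, f x ∂μ| ≤ C := by
  simpa using norm_integral_le_of_norm_le_const (μ := μ) (f := f) (ae_of_all _ hC)

lemma abs_heatSemigroup_le {f : ℝ → ℝ} {C : ℝ} (hC : ∀ x, |f x| ≤ C) (t x : ℝ) :
    |heatSemigroup t f x| ≤ C := abs_integral_le_of_bound fun _ => hC _

lemma IsJumpDensity.hasSum_semigroup (hp : IsJumpDensity p) {t : ℝ} (ht : 0 ≤ t)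
    {f : ℝ → ℝ} (hf : Continuous f) {C : ℝ} (hC : ∀ x, |f x| ≤ C) (x : ℝ) :
    HasSum (fun n : ℕ => Real.exp (-t) * t ^ n / (n.factorial : ℝ) *
      ∫ w, heatSemigroup t f (x + w) ∂(jumpSumLaw p n)) (semigroup p t f x) := by
  rw [hp.semigroup_eq_integral_integral ht hf hC]
  refine hp.hasSum_integral_totalJumpLaw ht (f := fun w => heatSemigroup t f (x + w)) ?_
    (C := C) (fun w => abs_heatSemigroup_le hC _ _)
  exact ((continuous_heatSemigroup hf hC).comp (f := fun w => (t, x + w))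
    (by fun_prop)).aestronglyMeasurable

lemma summable_pow_div_factorial_mul (T C : ℝ) :
    Summable fun n : ℕ => T ^ n / (n.factorial : ℝ) * C :=
  (Real.summable_pow_div_factorial T).mul_right C

/-- Weierstrass test on each slab `0 ≤ t ≤ T`, with majorant `C T^n / n!`. -/
lemma IsJumpDensity.continuousOn_semigroup (hp : IsJumpDensity p) {f : ℝ → ℝ}
    (hf : Continuous f) {C : ℝ} (hC : ∀ x, |f x| ≤ C) :
    ContinuousOn (fun q : ℝ × ℝ => semigroup p q.1 f q.2) (Set.Ici 0 ×ˢ Set.univ) := by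
  have := hp.isProbabilityMeasure_jumpSumLaw
  have hcont : ∀ n, Continuous fun q : ℝ × ℝ =>
      ∫ w, heatSemigroup q.1 f (q.2 + w) ∂(jumpSumLaw p n) := fun n =>
    continuous_of_dominated (bound := fun _ => C)
      (fun q => ((continuous_heatSemigroup hf hC).comp (f := fun w => (q.1, q.2 + w))
        (by fun_prop)).aestronglyMeasurable)
      (fun q => ae_of_all _ fun z => abs_heatSemigroup_le hC _ _) (integrable_const _)
      (ae_of_all _ fun z => (continuous_heatSemigroup hf hC).comp
        (f := fun q : ℝ × ℝ => (q.1, q.2 + z)) (by fun_prop))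
  have key : ∀ T : ℝ, ContinuousOn (fun q : ℝ × ℝ => semigroup p q.1 f q.2)
      (Set.Icc 0 T ×ˢ Set.univ) := by
    intro T
    have h := continuousOn_tsum (s := Set.Icc 0 T ×ˢ (Set.univ : Set ℝ))
      (f := fun (n : ℕ) (q : ℝ × ℝ) => Real.exp (-q.1) * q.1 ^ n / (n.factorial : ℝ) *
        ∫ w, heatSemigroup q.1 f (q.2 + w) ∂(jumpSumLaw p n))
      (u := fun n => T ^ n / (n.factorial : ℝ) * C)
      (fun n => Continuous.continuousOn (by have := hcont n; fun_prop))
      (summable_pow_div_factorial_mul T C) ?_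
    · exact h.congr fun q hq => ((hp.hasSum_semigroup hq.1.1 hf hC q.2).tsum_eq).symm
    · rintro n ⟨t, x⟩ ⟨⟨h0, hT⟩, -⟩
      simp only at h0 hT ⊢
      have hT0 : 0 ≤ T := h0.trans hT
      rw [norm_mul, Real.norm_of_nonneg (by positivity)]
      gcongr
      · rw [← one_mul (T ^ n)]
        have := Real.exp_le_one_iff.2 (neg_nonpos.2 h0)
        gcongr
      · exact abs_integral_le_of_bound fun _ => abs_heatSemigroup_le hC _ _
  -- The slab up to time `t + 1` is a neighbourhood of `(t, x)` within the closed half-plane.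
  rintro ⟨t, x⟩ ⟨ht, -⟩
  refine (key (t + 1) (t, x) ⟨⟨ht, by simp⟩, trivial⟩).mono_of_mem_nhdsWithin ?_
  rw [nhdsWithin_prod_eq, nhdsWithin_univ]
  refine prod_mem_prod ?_ univ_mem
  rw [← Set.Ici_inter_Iic]
  exact inter_mem_nhdsWithin _ (Iic_mem_nhds (by simp))

lemma IsJumpDensity.continuous_semigroup (hp : IsJumpDensity p) {t : ℝ} (ht : 0 ≤ t) {f : ℝ → ℝ}
    (hf : Continuous f) {C : ℝ} (hC : ∀ x, |f x| ≤ C) : Continuous (semigroup p t f) := by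
  rw [← continuousOn_univ]
  exact (hp.continuousOn_semigroup hf hC).comp (f := fun x => (t, x)) (by fun_prop)
    fun x _ => ⟨ht, trivial⟩

lemma IsJumpDensity.semigroup_zero (hp : IsJumpDensity p) (f : ℝ → ℝ) (x : ℝ) :
    semigroup p 0 f x = f x := by
  rw [semigroup, hp.transitionLaw_zero, integral_dirac]

lemma IsJumpDensity.tendsto_semigroup (hp : IsJumpDensity p) {f : ℝ → ℝ}
    (hf : Continuous f) {C : ℝ} (hC : ∀ x, |f x| ≤ C) (x : ℝ) :
    Tendsto (fun t => semigroup p t f x) (𝓝[>] 0) (𝓝 (f x)) := by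
  have h : ContinuousOn (fun t => semigroup p t f x) (Set.Ici 0) :=
    (hp.continuousOn_semigroup hf hC).comp (f := fun t => (t, x)) (by fun_prop)
      fun t ht => ⟨ht, trivial⟩
  have h0 := h 0 Set.self_mem_Ici
  rw [ContinuousWithinAt, hp.semigroup_zero] at h0
  exact h0.mono_left (nhdsWithin_mono _ Set.Ioi_subset_Ici_self)

lemma IsJumpDensity.abs_semigroup_le (hp : IsJumpDensity p) {t : ℝ} (ht : 0 ≤ t) {f : ℝ → ℝ}
    {C : ℝ} (hC : ∀ x, |f x| ≤ C) (x : ℝ) : |semigroup p t f x| ≤ C := by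
  have := hp.isProbabilityMeasure_transitionLaw ht x
  exact abs_integral_le_of_bound hC

end Semigroup

/-! ### The generator -/

section Generator

lemma exists_taylor_two {f : ℝ → ℝ} (hf : ContDiff ℝ 2 f) (x h : ℝ) :
    ∃ ξ, |ξ - x| ≤ |h| ∧
      f (x + h) = f x + deriv f x * h + iteratedDeriv 2 f ξ * h ^ 2 / 2 := by
  rcases eq_or_ne h 0 with rfl | h0
  · exact ⟨x, by simp, by simp⟩
  have hne : x ≠ x + h := by simpa using h0
  obtain ⟨ξ, hξ, h⟩ := taylor_mean_remainder_lagrange_iteratedDeriv (n := 1) hne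
    (hf.contDiffOn.of_le (by norm_num))
  refine ⟨ξ, ?_, ?_⟩
  · have := Set.abs_sub_left_of_mem_uIcc (Set.uIoo_subset_uIcc_self hξ)
    simpa using this
  · rw [taylorWithinEval_succ, taylor_within_zero_eval, iteratedDerivWithin_one,
      (hf.differentiable (by norm_num) x).derivWithin
        (uniqueDiffOn_uIcc hne x Set.left_mem_uIcc)] at h
    simp at h
    linarith

lemma integral_sq_gaussianReal_zero_one : ∫ u, u ^ 2 ∂(gaussianReal 0 1) = 1 := by
  have h := variance_eq_integral (μ := gaussianReal 0 1) (X := fun x => x) (by fun_prop)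
  rw [variance_fun_id_gaussianReal] at h
  simpa using h.symm

lemma integrable_gaussianReal_id : Integrable (fun u : ℝ => u) (gaussianReal 0 1) :=
  (memLp_id_gaussianReal 1).integrable (by simp)

lemma integrable_gaussianReal_sq : Integrable (fun u : ℝ => u ^ 2) (gaussianReal 0 1) :=
  (memLp_id_gaussianReal 2).integrable_sq

/-- The generator of the heat semigroup is `½ f''`. -/
lemma tendsto_heatSemigroup_sub_div {f : ℝ → ℝ} (hf : ContDiff ℝ 2 f) {C : ℝ}
    (hC : ∀ x, |f x| ≤ C) (hC2 : ∀ x, |iteratedDeriv 2 f x| ≤ C) (x : ℝ) :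
    Tendsto (fun t : ℝ => (heatSemigroup t f x - f x) / t) (𝓝[>] 0)
      (𝓝 (1 / 2 * iteratedDeriv 2 f x)) := by
  have hfc := hf.continuous
  have hC0 : 0 ≤ C := (abs_nonneg _).trans (hC 0)
  -- The first order Taylor term has Gaussian mean zero, so subtracting it costs nothing and leaves
  -- an integrand of order `t`.
  have key : ∀ t, 0 < t → (heatSemigroup t f x - f x) / t =
      ∫ u, (f (x + √t * u) - f x - deriv f x * (√t * u)) / t ∂(gaussianReal 0 1) := by
    intro t ht
    have hi : Integrable (fun u => f (x + √t * u)) (gaussianReal 0 1) :=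
      Integrable.of_bound (by fun_prop) C (ae_of_all _ fun z => hC _)
    have hi2 : Integrable (fun u => f (x + √t * u) - f x) (gaussianReal 0 1) :=
      hi.sub (integrable_const _)
    rw [integral_div, integral_sub hi2
      ((integrable_gaussianReal_id.const_mul _).const_mul _), integral_sub hi (integrable_const _),
      integral_const_mul, integral_const_mul, integral_id_gaussianReal, heatSemigroup]
    simp
  have hlim : 1 / 2 * iteratedDeriv 2 f x =
      ∫ u, iteratedDeriv 2 f x / 2 * u ^ 2 ∂(gaussianReal 0 1) := by
    rw [integral_const_mul, integral_sq_gaussianReal_zero_one]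
    ring
  rw [hlim]
  refine Tendsto.congr' (f₁ := fun t =>
    ∫ u, (f (x + √t * u) - f x - deriv f x * (√t * u)) / t ∂(gaussianReal 0 1)) ?_ ?_
  · filter_upwards [self_mem_nhdsWithin] with t ht using (key t ht).symm
  have hrep : ∀ (t : ℝ) (_ : 0 < t) (u : ℝ), ∃ ξ, |ξ - x| ≤ |√t * u| ∧
      (f (x + √t * u) - f x - deriv f x * (√t * u)) / t = iteratedDeriv 2 f ξ / 2 * u ^ 2 := by
    intro t ht u
    obtain ⟨ξ, h1, h2⟩ := exists_taylor_two hf x (√t * u)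
    refine ⟨ξ, h1, ?_⟩
    rw [h2, mul_pow, Real.sq_sqrt ht.le]
    field_simp
    ring
  refine tendsto_integral_filter_of_dominated_convergence (fun u => C / 2 * u ^ 2)
    (Eventually.of_forall fun t => by fun_prop) ?_ (integrable_gaussianReal_sq.const_mul _) ?_
  · filter_upwards [self_mem_nhdsWithin] with t ht
    refine ae_of_all _ fun u => ?_
    obtain ⟨ξ, -, h⟩ := hrep t ht u
    rw [h, Real.norm_eq_abs, abs_mul, abs_div, abs_two, abs_of_nonneg (sq_nonneg u)]
    gcongr
    exact hC2 _
  · refine ae_of_all _ fun u => ?_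
    -- Here `u` is fixed and only `t` varies; the intermediate point is never integrated, so its
    -- measurability in `u` is not an issue.
    choose! ξ h1 h2 using fun t (ht : 0 < t) => hrep t ht u
    have hξ : Tendsto ξ (𝓝[>] 0) (𝓝 x) := by
      rw [tendsto_iff_norm_sub_tendsto_zero]
      have h0 : Tendsto (fun t : ℝ => |√t * u|) (𝓝[>] 0) (𝓝 0) := by
        have : Continuous fun t : ℝ => |√t * u| := by fun_prop
        simpa using (this.tendsto 0).mono_left nhdsWithin_le_nhds
      refine squeeze_zero' (Eventually.of_forall fun t => norm_nonneg _) ?_ h0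
      filter_upwards [self_mem_nhdsWithin] with t ht using h1 t ht
    have hcont : Continuous (iteratedDeriv 2 f) := hf.continuous_iteratedDeriv 2 le_rfl
    refine Tendsto.congr' (f₁ := fun t => iteratedDeriv 2 f (ξ t) / 2 * u ^ 2) ?_
      ((((hcont.tendsto x).comp hξ).div_const 2).mul_const _)
    filter_upwards [self_mem_nhdsWithin] with t ht using (h2 t ht).symm

variable {p : ℝ → ℝ → ℝ}

/-- In the time interval `[0, t]` there are two jumps or more with probability at most `t²`. -/
lemma IsJumpDensity.abs_semigroup_sub_le (hp : IsJumpDensity p) {t : ℝ} (ht : 0 ≤ t)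
    {f : ℝ → ℝ} (hf : Continuous f) {C : ℝ} (hC : ∀ x, |f x| ≤ C) (x : ℝ) :
    |semigroup p t f x - Real.exp (-t) * heatSemigroup t f x -
      Real.exp (-t) * t * ∫ w, heatSemigroup t f (x + w) ∂(jumpLaw p)| ≤ t ^ 2 * C := by
  have := hp.isProbabilityMeasure_jumpSumLaw
  have hC0 : 0 ≤ C := (abs_nonneg _).trans (hC 0)
  -- Removing the first two terms from both the series and the Poisson weights lets the tail of the
  -- one bound the tail of the other.
  have h := (hasSum_nat_add_iff' 2).2 (hp.hasSum_semigroup ht hf hC x)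
  have hw := ((hasSum_nat_add_iff' 2).2 (hasSum_poisson_weights t)).mul_right C
  have hone : jumpSumLaw p 1 = jumpLaw p := by
    have := hp.isProbabilityMeasure_jumpLaw
    simp [jumpSumLaw]
  simp only [Finset.sum_range_succ, Finset.sum_range_zero, hone] at h hw
  have hzero : jumpSumLaw p 0 = Measure.dirac 0 := rfl
  simp [hzero] at h hw
  have hle := h.norm_le_of_bounded hw fun n => by
    rw [norm_mul, Real.norm_of_nonneg (by positivity)]
    gcongr
    exact abs_integral_le_of_bound fun _ => abs_heatSemigroup_le hC _ _
  rw [sub_sub, ← Real.norm_eq_abs]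
  refine hle.trans ?_
  gcongr
  -- As `e^{-t} ≥ 1 - t`, the tail `1 - e^{-t}(1 + t)` is at most `1 - (1 - t)(1 + t) = t²`.
  nlinarith [Real.add_one_le_exp (-t)]

lemma IsJumpDensity.integral_translate_mul (hp : IsJumpDensity p) (f : ℝ → ℝ) (x : ℝ) :
    ∫ y, p x y * f y = ∫ z, f (x + z) ∂(jumpLaw p) := by
  rw [hp.integral_jumpLaw, ← integral_add_left_eq_self _ x]
  simp_rw [hp.translation x, add_sub_cancel_left]

lemma IsJumpDensity.integral_jump (hp : IsJumpDensity p) {f : ℝ → ℝ} (hf : Continuous f) {C : ℝ}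
    (hC : ∀ x, |f x| ≤ C) (x : ℝ) :
    ∫ y, p x y * (f y - f x) = (∫ z, f (x + z) ∂(jumpLaw p)) - f x := by
  have := hp.isProbabilityMeasure_jumpLaw
  rw [hp.integral_translate_mul (fun y => f y - f x), integral_sub _ (integrable_const _)]
  · simp
  · exact Integrable.of_bound (by fun_prop) C (ae_of_all _ fun z => hC _)

lemma IsJumpDensity.tendsto_generator (hp : IsJumpDensity p) {f : ℝ → ℝ} (hf : ContDiff ℝ 2 f)
    {C : ℝ} (hC : ∀ x, |f x| ≤ C) (hC2 : ∀ x, |iteratedDeriv 2 f x| ≤ C) (x : ℝ) :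
    Tendsto (fun t : ℝ => (semigroup p t f x - f x) / t) (𝓝[>] 0) (𝓝 (generator p f x)) := by
  have := hp.isProbabilityMeasure_jumpLaw
  have hfc := hf.continuous
  have hexp : Tendsto (fun t : ℝ => Real.exp (-t)) (𝓝[>] 0) (𝓝 1) := by
    have : Continuous fun t : ℝ => Real.exp (-t) := by fun_prop
    simpa using (this.tendsto 0).mono_left nhdsWithin_le_nhds
  have hexp' : Tendsto (fun t : ℝ => (Real.exp (-t) - 1) / t) (𝓝[>] 0) (𝓝 (-1)) := by
    have h : HasDerivAt (fun t : ℝ => Real.exp (-t)) (-1) 0 := by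
      simpa using (hasDerivAt_neg (0 : ℝ)).exp
    have := (hasDerivAt_iff_tendsto_slope.1 h).mono_left
      (nhdsWithin_mono _ fun t (ht : 0 < t) => ht.ne')
    refine this.congr fun t => ?_
    simp [slope_def_field]
  have hjump : Tendsto (fun t : ℝ => ∫ w, heatSemigroup t f (x + w) ∂(jumpLaw p)) (𝓝[>] 0)
      (𝓝 (∫ w, f (x + w) ∂(jumpLaw p))) := by
    have hcont := continuous_heatSemigroup hfc hC
    have : Continuous fun t : ℝ => ∫ w, heatSemigroup t f (x + w) ∂(jumpLaw p) :=
      continuous_of_dominated (bound := fun _ => C)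
        (fun t => (hcont.comp (f := fun w => (t, x + w)) (by fun_prop)).aestronglyMeasurable)
        (fun t => ae_of_all _ fun z => abs_heatSemigroup_le hC _ _) (integrable_const _)
        (ae_of_all _ fun z => hcont.comp (f := fun t : ℝ => (t, x + z)) (by fun_prop))
    simpa [heatSemigroup] using (this.tendsto 0).mono_left nhdsWithin_le_nhds
  set a : ℝ → ℝ := fun t => heatSemigroup t f x
  set b : ℝ → ℝ := fun t => ∫ w, heatSemigroup t f (x + w) ∂(jumpLaw p)
  have hrem : Tendsto (fun t : ℝ => (semigroup p t f x - Real.exp (-t) * a t -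
      Real.exp (-t) * t * b t) / t) (𝓝[>] 0) (𝓝 0) := by
    refine squeeze_zero_norm' (a := fun t => t * C) ?_ ?_
    · filter_upwards [self_mem_nhdsWithin] with t (ht : 0 < t)
      rw [norm_div, Real.norm_of_nonneg ht.le, div_le_iff₀ ht]
      exact (hp.abs_semigroup_sub_le ht.le hfc hC x).trans (by nlinarith)
    · have : Continuous fun t : ℝ => t * C := by fun_prop
      simpa using (this.tendsto 0).mono_left nhdsWithin_le_nhds
  -- The difference quotient splits into the remainder, `e^{-t}` times the heat quotient,
  -- `f(x)(e^{-t} - 1)/t` and the one-jump term. Their limits are `0`, `½ f''(x)`, `-f(x)` and the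
  -- mean of `f` after one jump.
  have hsum := ((hrem.add (hexp.mul (tendsto_heatSemigroup_sub_div hf hC hC2 x))).add
    (hexp'.mul_const (f x))).add (hexp.mul hjump)
  rw [generator, hp.integral_jump hfc hC]
  refine (hsum.congr' ?_).trans (le_of_eq (congrArg 𝓝 (by ring)))
  filter_upwards [self_mem_nhdsWithin] with t (ht : 0 < t)
  simp only [a, b]
  field_simp
  ring

lemma IsJumpDensity.isMarkovSemigroupWithGenerator (hp : IsJumpDensity p) :
    IsMarkovSemigroupWithGenerator (transitionLaw p) (generator p) where
  isProbabilityMeasure _ ht x := hp.isProbabilityMeasure_transitionLaw ht x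
  zero := hp.transitionLaw_zero
  continuous _ ht f := hp.continuous_semigroup ht f.continuous f.norm_coe_le_norm
  add _ _ hs ht f x := hp.integral_transitionLaw_add hs ht f x
  generator _ hf := fun ⟨_, hC⟩ x => hp.tendsto_generator hf (fun y => (hC y).1)
    (fun y => (hC y).2.2) x

end Generator

/-! ### One-time marginals of the process -/

section PathLaw

variable {p : ℝ → ℝ → ℝ} {Ω : Type*} [MeasurableSpace Ω] {P : Measure Ω}

lemma IsPoissonProcess.hasLaw {N : ℝ≥0 → Ω → ℕ} (hN : IsPoissonProcess N P) (t : ℝ≥0) :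
    HasLaw (N t) (poissonMeasure t) P := by
  have h := hN.increments 0 t zero_le
  rw [tsub_zero] at h
  refine h.congr ?_
  filter_upwards [hN.zero] with w hw
  rw [hw, Nat.sub_zero]

lemma IsJumpDensity.hasLaw_jumpSum (hp : IsJumpDensity p) [IsProbabilityMeasure P]
    {Z : ℕ → Ω → ℝ} (hZ : ∀ i, HasLaw (Z i) (jumpLaw p) P) (hind : iIndepFun Z P) (n : ℕ) :
    HasLaw (fun w => ∑ i ∈ Finset.range n, Z i w) (jumpSumLaw p n) P := by
  have := hp.isProbabilityMeasure_jumpLaw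
  induction n with
  | zero =>
    refine ⟨by simp, ?_⟩
    simp [jumpSumLaw, Measure.map_const]
  | succ n ih =>
    have := hp.isProbabilityMeasure_jumpSumLaw n
    simp_rw [Finset.sum_range_succ]
    refine IndepFun.hasLaw_fun_add ih (hZ n) ?_
    have h := hind.indepFun_finsetSum_of_notMem₀ (fun i => (hZ i).aemeasurable)
      (Finset.notMem_range_self (n := n))
    convert h using 1
    ext w
    simp

lemma measurable_sum_range :
    Measurable fun q : ℕ × (ℕ → ℝ) => ∑ i ∈ Finset.range q.1, q.2 i :=
  measurable_from_prod_countable_right fun n =>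
    Finset.measurable_sum (Finset.range n) fun i _ => measurable_pi_apply i

/-- Independence makes the joint law of the count and the jumps a product; summing over the
countably many counts gives the Poisson mixture. -/
lemma IsJumpDensity.hasLaw_totalJump (hp : IsJumpDensity p) [IsProbabilityMeasure P]
    {Z : ℕ → Ω → ℝ} (hZ : ∀ i, HasLaw (Z i) (jumpLaw p) P) (hind : iIndepFun Z P)
    {M : Ω → ℕ} {t : ℝ≥0} (hM : HasLaw M (poissonMeasure t) P)
    (hMZ : IndepFun M (fun w i => Z i w) P) :
    HasLaw (fun w => ∑ i ∈ Finset.range (M w), Z i w) (totalJumpLaw p t) P := by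
  have hZm : AEMeasurable (fun w i => Z i w) P :=
    aemeasurable_pi_lambda _ fun i => (hZ i).aemeasurable
  have hm : AEMeasurable (fun w => (M w, fun i => Z i w)) P := hM.aemeasurable.prodMk hZm
  refine ⟨measurable_sum_range.comp_aemeasurable hm, ?_⟩
  have := Measure.isProbabilityMeasure_map hZm
  rw [show (fun w => ∑ i ∈ Finset.range (M w), Z i w) =
      (fun q : ℕ × (ℕ → ℝ) => ∑ i ∈ Finset.range q.1, q.2 i) ∘ (fun w => (M w, fun i => Z i w))
      from rfl, ← AEMeasurable.map_map_of_aemeasurable measurable_sum_range.aemeasurable hm,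
    hMZ.map_prod_eq_prod_map_map hM.aemeasurable hZm, hM.map_eq]
  refine Measure.ext fun s hs => ?_
  rw [Measure.map_apply measurable_sum_range hs, Measure.prod_apply (measurable_sum_range hs),
    lintegral_countable', totalJumpLaw, Measure.sum_apply _ hs]
  refine tsum_congr fun n => ?_
  have hms : Measurable fun z : ℕ → ℝ => ∑ i ∈ Finset.range n, z i :=
    Finset.measurable_sum _ fun i _ => measurable_pi_apply i
  have hset : Prod.mk n ⁻¹' ((fun q : ℕ × (ℕ → ℝ) => ∑ i ∈ Finset.range q.1, q.2 i) ⁻¹' s) =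
      (fun z : ℕ → ℝ => ∑ i ∈ Finset.range n, z i) ⁻¹' s := rfl
  rw [hset, ← Measure.map_apply hms hs, AEMeasurable.map_map_of_aemeasurable hms.aemeasurable hZm,
    poissonMeasure_singleton, Measure.smul_apply, smul_eq_mul, mul_comm,
    ← (hp.hasLaw_jumpSum hZ hind n).map_eq]
  rfl

lemma IsJumpDensity.hasLaw_process (hp : IsJumpDensity p) {x : ℝ} {B : ℝ≥0 → Ω → ℝ}
    {N : ℝ≥0 → Ω → ℕ} {Z : ℕ → Ω → ℝ} {X : ℝ≥0 → Ω → ℝ}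
    (h : IsBrownianMotionWithJumps p x B N Z X P) (t : ℝ≥0) :
    HasLaw (X t) (transitionLaw p t x) P := by
  have hB := h.brownian.hasLaw_eval t
  have := hB.isProbabilityMeasure
  have := hp.isProbabilityMeasure_totalJumpLaw t.coe_nonneg
  have hY := hp.hasLaw_totalJump h.jumps_law h.jumps_indep (h.poisson.hasLaw t)
    (h.indep_poisson_jumps.comp (measurable_pi_apply t) measurable_id)
  have hψ : Measurable fun q : (ℝ≥0 → ℕ) × (ℕ → ℝ) => ∑ i ∈ Finset.range (q.1 t), q.2 i :=
    measurable_sum_range.comp (g := fun q : ℕ × (ℕ → ℝ) => ∑ i ∈ Finset.range q.1, q.2 i)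
      (f := fun q : (ℝ≥0 → ℕ) × (ℕ → ℝ) => (q.1 t, q.2))
      (((measurable_pi_apply t).comp measurable_fst).prodMk measurable_snd)
  have hind : IndepFun (B t) (fun w => ∑ i ∈ Finset.range (N t w), Z i w) P :=
    h.indep_brownian.comp (measurable_pi_apply t) hψ
  have hsum := IndepFun.hasLaw_fun_add hB hY hind
  have hadd : HasLaw (fun z => x + z) (transitionLaw p t x)
      ((gaussianReal 0 t).conv (totalJumpLaw p t)) :=
    ⟨by fun_prop, by rw [transitionLaw, Real.toNNReal_coe]⟩
  refine (hadd.comp hsum).congr (ae_of_all _ fun w => ?_)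
  simp [h.eq t w, add_assoc]

lemma IsJumpDensity.integral_process (hp : IsJumpDensity p) {x : ℝ} {B : ℝ≥0 → Ω → ℝ}
    {N : ℝ≥0 → Ω → ℕ} {Z : ℕ → Ω → ℝ} {X : ℝ≥0 → Ω → ℝ}
    (h : IsBrownianMotionWithJumps p x B N Z X P) (t : ℝ≥0) (f : ℝ →ᵇ ℝ) :
    ∫ w, f (X t w) ∂P = semigroup p t f x :=
  (hp.hasLaw_process h t).integral_comp f.continuous.aestronglyMeasurable

end PathLaw

/-! ### From the heat equation to the free evolution -/

section HeatFunctions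

/-- `H t x` solves the heat equation `∂ₜ H = ½ H₂` for `t > 0`, with spatial derivatives `H₁`, `H₂`
and bounds which are locally uniform in `t > 0`. -/
structure IsHeatFunction (H H₁ H₂ : ℝ → ℝ → ℝ) : Prop where
  hasDerivAt : ∀ t, 0 < t → ∀ x, HasDerivAt (H t) (H₁ t x) x
  hasDerivAt' : ∀ t, 0 < t → ∀ x, HasDerivAt (H₁ t) (H₂ t x) x
  continuous : ∀ t, 0 < t → Continuous (H₂ t)
  time : ∀ t, 0 < t → ∀ x, HasDerivAt (fun s => H s x) (1 / 2 * H₂ t x) t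
  bound : ∀ a b, 0 < a → ∃ C, ∀ t ∈ Set.Icc a b, ∀ x, |H t x| ≤ C ∧ |H₁ t x| ≤ C ∧ |H₂ t x| ≤ C

/-- The convolution of a function and a measure. -/
def convMeasure (μ : Measure ℝ) (f : ℝ → ℝ) (x : ℝ) : ℝ := ∫ w, f (x - w) ∂μ

lemma hasDerivAt_convMeasure (μ : Measure ℝ) [IsFiniteMeasure μ] {f f' : ℝ → ℝ}
    (hf : ∀ x, HasDerivAt f (f' x) x) (hf' : Continuous f') {C : ℝ} (hC : ∀ x, |f x| ≤ C)
    {C' : ℝ} (hC' : ∀ x, |f' x| ≤ C') (x : ℝ) :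
    HasDerivAt (convMeasure μ f) (convMeasure μ f' x) x := by
  have hfc : Continuous f := continuous_iff_continuousAt.2 fun x => (hf x).continuousAt
  exact (hasDerivAt_integral_of_dominated_loc_of_deriv_le (μ := μ) (bound := fun _ => C')
    (F := fun x w => f (x - w)) (F' := fun x w => f' (x - w)) univ_mem
    (Eventually.of_forall fun y => by fun_prop)
    (Integrable.of_bound (by fun_prop) C (ae_of_all _ fun w => hC _)) (by fun_prop)
    (ae_of_all _ fun w y _ => hC' _) (integrable_const _)
    (ae_of_all _ fun w y _ => (hf (y - w)).comp_sub_const y w)).2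

lemma continuous_convMeasure (μ : Measure ℝ) [IsFiniteMeasure μ] {f : ℝ → ℝ}
    (hf : Continuous f) {C : ℝ} (hC : ∀ x, |f x| ≤ C) : Continuous (convMeasure μ f) :=
  continuous_of_dominated (bound := fun _ => C) (fun x => by fun_prop)
    (fun x => ae_of_all _ fun w => hC _) (integrable_const _) (ae_of_all _ fun w => by fun_prop)

lemma abs_convMeasure_le {μ : Measure ℝ} [IsProbabilityMeasure μ] {f : ℝ → ℝ} {C : ℝ}
    (hC : ∀ x, |f x| ≤ C) (x : ℝ) : |convMeasure μ f x| ≤ C :=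
  abs_integral_le_of_bound fun _ => hC _

lemma convMeasure_conv (μ ν : Measure ℝ) [IsFiniteMeasure μ] [IsFiniteMeasure ν] {f : ℝ → ℝ}
    (hf : Continuous f) {C : ℝ} (hC : ∀ x, |f x| ≤ C) (x : ℝ) :
    convMeasure (μ.conv ν) f x = ∫ v, convMeasure ν f (x - v) ∂μ := by
  rw [convMeasure, integral_conv (Integrable.of_bound (by fun_prop) C (ae_of_all _ fun w => hC _))]
  simp_rw [convMeasure, sub_sub]

variable {H H₁ H₂ : ℝ → ℝ → ℝ}

lemma IsHeatFunction.bound_at (h : IsHeatFunction H H₁ H₂) {t : ℝ} (ht : 0 < t) :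
    ∃ C, ∀ x, |H t x| ≤ C ∧ |H₁ t x| ≤ C ∧ |H₂ t x| ≤ C := by
  obtain ⟨C, hC⟩ := h.bound t t ht
  exact ⟨C, hC t ⟨le_rfl, le_rfl⟩⟩

lemma IsHeatFunction.continuous₀ (h : IsHeatFunction H H₁ H₂) {t : ℝ} (ht : 0 < t) :
    Continuous (H t) :=
  continuous_iff_continuousAt.2 fun x => (h.hasDerivAt t ht x).continuousAt

lemma IsHeatFunction.continuous₁ (h : IsHeatFunction H H₁ H₂) {t : ℝ} (ht : 0 < t) :
    Continuous (H₁ t) :=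
  continuous_iff_continuousAt.2 fun x => (h.hasDerivAt' t ht x).continuousAt

/-- The bounds are uniform in space, so they dominate the differentiated integrands and survive
averaging with the same constants. Hence they are uniform over all terms of the Poisson series. -/
lemma IsHeatFunction.conv (h : IsHeatFunction H H₁ H₂) (μ : Measure ℝ)
    [IsProbabilityMeasure μ] :
    IsHeatFunction (fun t => convMeasure μ (H t)) (fun t => convMeasure μ (H₁ t))
      (fun t => convMeasure μ (H₂ t)) where
  hasDerivAt t ht x := by
    obtain ⟨C, hC⟩ := h.bound_at ht
    exact hasDerivAt_convMeasure μ (h.hasDerivAt t ht) (h.continuous₁ ht) (fun x => (hC x).1)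
      (fun x => (hC x).2.1) x
  hasDerivAt' t ht x := by
    obtain ⟨C, hC⟩ := h.bound_at ht
    exact hasDerivAt_convMeasure μ (h.hasDerivAt' t ht) (h.continuous t ht) (fun x => (hC x).2.1)
      (fun x => (hC x).2.2) x
  continuous t ht := by
    obtain ⟨C, hC⟩ := h.bound_at ht
    exact continuous_convMeasure μ (h.continuous t ht) (fun x => (hC x).2.2)
  time t ht x := by
    -- The time window stays away from `0`, where no bounds are available.
    obtain ⟨C, hC⟩ := h.bound (t / 2) (2 * t) (by positivity)
    have hmem : Set.Icc (t / 2) (2 * t) ∈ 𝓝 t := Icc_mem_nhds (by linarith) (by linarith)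
    have hpos : ∀ s ∈ Set.Icc (t / 2) (2 * t), 0 < s := fun s hs => by linarith [hs.1]
    have hd := (hasDerivAt_integral_of_dominated_loc_of_deriv_le (μ := μ) (bound := fun _ => C)
      (F := fun s w => H s (x - w)) (F' := fun s w => 1 / 2 * H₂ s (x - w)) (x₀ := t) hmem ?_ ?_ ?_
      (ae_of_all _ fun w s hs => ?_) (integrable_const _)
      (ae_of_all _ fun w s hs => h.time s (hpos s hs) _)).2
    · rwa [integral_const_mul] at hd
    · filter_upwards [hmem] with s hs
      have := h.continuous₀ (hpos s hs)
      fun_prop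
    · have := h.continuous₀ ht
      exact Integrable.of_bound (by fun_prop) C
        (ae_of_all _ fun w => (hC t (mem_of_mem_nhds hmem) _).1)
    · have := h.continuous t ht
      fun_prop
    · have := (hC s hs (x - w)).2.2
      rw [norm_mul, Real.norm_eq_abs, Real.norm_eq_abs, abs_of_pos (by norm_num : (0 : ℝ) < 1 / 2)]
      linarith [abs_nonneg (H₂ s (x - w))]
  bound a b ha := by
    obtain ⟨C, hC⟩ := h.bound a b ha
    exact ⟨C, fun t ht x => ⟨abs_convMeasure_le (fun x => (hC t ht x).1) x,
      abs_convMeasure_le (fun x => (hC t ht x).2.1) x,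
      abs_convMeasure_le (fun x => (hC t ht x).2.2) x⟩⟩

variable {p : ℝ → ℝ → ℝ}

/-- `e^t` times the convolution of `H t` and the law of the sum of the jumps up to time `t`. -/
def jumpEvolution (p : ℝ → ℝ → ℝ) (H : ℝ → ℝ → ℝ) (t x : ℝ) : ℝ :=
  Real.exp t * convMeasure (totalJumpLaw p t) (H t) x

lemma IsJumpDensity.hasSum_exp_mul_convMeasure (hp : IsJumpDensity p) {t : ℝ} (ht : 0 ≤ t)
    {f : ℝ → ℝ} (hf : Continuous f) {C : ℝ} (hC : ∀ x, |f x| ≤ C) (x : ℝ) :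
    HasSum (fun n : ℕ => t ^ n / (n.factorial : ℝ) * convMeasure (jumpSumLaw p n) f x)
      (Real.exp t * convMeasure (totalJumpLaw p t) f x) := by
  have h := (hp.hasSum_integral_totalJumpLaw ht (f := fun w => f (x - w)) (by fun_prop)
    (fun w => hC _)).mul_left (Real.exp t)
  refine h.congr_fun fun n => ?_
  rw [smul_eq_mul, ← mul_assoc, ← mul_div_assoc, ← mul_assoc, ← Real.exp_add, add_neg_cancel,
    Real.exp_zero, one_mul]
  rfl

lemma IsHeatFunction.hasSum_jumpEvolution (h : IsHeatFunction H H₁ H₂) (hp : IsJumpDensity p)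
    {t : ℝ} (ht : 0 < t) (x : ℝ) :
    HasSum (fun n : ℕ => t ^ n / (n.factorial : ℝ) * convMeasure (jumpSumLaw p n) (H t) x)
      (jumpEvolution p H t x) := by
  obtain ⟨C, hC⟩ := h.bound_at ht
  exact hp.hasSum_exp_mul_convMeasure ht.le (h.continuous₀ ht) (fun x => (hC x).1) x

lemma IsHeatFunction.hasDerivAt_jumpEvolution (h : IsHeatFunction H H₁ H₂) (hp : IsJumpDensity p)
    {t : ℝ} (ht : 0 < t) (x : ℝ) :
    HasDerivAt (jumpEvolution p H t) (jumpEvolution p H₁ t x) x := by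
  have := hp.isProbabilityMeasure_totalJumpLaw ht.le
  exact ((h.conv (totalJumpLaw p t)).hasDerivAt t ht x).const_mul _

lemma IsHeatFunction.hasDerivAt_jumpEvolution' (h : IsHeatFunction H H₁ H₂)
    (hp : IsJumpDensity p) {t : ℝ} (ht : 0 < t) (x : ℝ) :
    HasDerivAt (jumpEvolution p H₁ t) (jumpEvolution p H₂ t x) x := by
  have := hp.isProbabilityMeasure_totalJumpLaw ht.le
  exact ((h.conv (totalJumpLaw p t)).hasDerivAt' t ht x).const_mul _

lemma IsHeatFunction.continuous_jumpEvolution (h : IsHeatFunction H H₁ H₂)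
    (hp : IsJumpDensity p) {t : ℝ} (ht : 0 < t) : Continuous (jumpEvolution p H₂ t) := by
  have := hp.isProbabilityMeasure_totalJumpLaw ht.le
  exact continuous_const.mul ((h.conv (totalJumpLaw p t)).continuous t ht)

lemma IsHeatFunction.iteratedDeriv_jumpEvolution (h : IsHeatFunction H H₁ H₂)
    (hp : IsJumpDensity p) {t : ℝ} (ht : 0 < t) :
    iteratedDeriv 2 (jumpEvolution p H t) = jumpEvolution p H₂ t := by
  rw [iteratedDeriv_succ, iteratedDeriv_one,
    funext fun x => (h.hasDerivAt_jumpEvolution hp ht x).deriv]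
  exact funext fun x => (h.hasDerivAt_jumpEvolution' hp ht x).deriv

lemma IsHeatFunction.contDiff_jumpEvolution (h : IsHeatFunction H H₁ H₂) (hp : IsJumpDensity p)
    {t : ℝ} (ht : 0 < t) : ContDiff ℝ 2 (jumpEvolution p H t) := by
  rw [show (2 : WithTop ℕ∞) = 1 + 1 by norm_num, contDiff_succ_iff_deriv]
  refine ⟨fun x => (h.hasDerivAt_jumpEvolution hp ht x).differentiableAt, by simp, ?_⟩
  rw [funext fun x => (h.hasDerivAt_jumpEvolution hp ht x).deriv, contDiff_one_iff_deriv]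
  refine ⟨fun x => (h.hasDerivAt_jumpEvolution' hp ht x).differentiableAt, ?_⟩
  rw [funext fun x => (h.hasDerivAt_jumpEvolution' hp ht x).deriv]
  exact h.continuous_jumpEvolution hp ht

/-- By translation invariance `p(z, y)` depends only on `y - z`, so the gain term is a convolution.
-/
lemma IsJumpDensity.integral_mul_jump (hp : IsJumpDensity p) (f : ℝ → ℝ) (y : ℝ) :
    ∫ z, f z * p z y = convMeasure (jumpLaw p) f y := by
  rw [convMeasure, hp.integral_jumpLaw, ← integral_sub_left_eq_self _ volume y]
  refine integral_congr_ae (ae_of_all _ fun z => ?_)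
  simp only [hp.translation (y - z), sub_sub_cancel]
  exact mul_comm _ _

lemma IsJumpDensity.integrable_mul_jump (hp : IsJumpDensity p) {f : ℝ → ℝ} (hf : Continuous f)
    {C : ℝ} (hC : ∀ x, |f x| ≤ C) (y : ℝ) : Integrable fun z => f z * p z y := by
  simp_rw [fun z => hp.translation z y]
  exact (hp.integrable.comp_sub_left y).bdd_mul hf.aestronglyMeasurable (ae_of_all _ hC)

/-- One further jump raises the convolution power by one while the weight stays; commutativity of
convolution moves that jump inside the series. -/
lemma IsHeatFunction.hasSum_convMeasure_jumpLaw_jumpEvolution (h : IsHeatFunction H H₁ H₂)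
    (hp : IsJumpDensity p) {t : ℝ} (ht : 0 < t) (x : ℝ) :
    HasSum (fun n : ℕ => t ^ n / (n.factorial : ℝ) * convMeasure (jumpSumLaw p (n + 1)) (H t) x)
      (convMeasure (jumpLaw p) (jumpEvolution p H t) x) := by
  have := hp.isProbabilityMeasure_jumpLaw
  have := hp.isProbabilityMeasure_jumpSumLaw
  have := hp.isProbabilityMeasure_totalJumpLaw ht.le
  obtain ⟨C, hC⟩ := h.bound_at ht
  have hH := h.continuous₀ ht
  have hs := hp.hasSum_exp_mul_convMeasure ht.le
    (continuous_convMeasure (jumpLaw p) hH (fun x => (hC x).1))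
    (fun x => abs_convMeasure_le (fun x => (hC x).1) x) x
  have e1 : convMeasure (jumpLaw p) (jumpEvolution p H t) x =
      Real.exp t * convMeasure (totalJumpLaw p t) (convMeasure (jumpLaw p) (H t)) x := by
    have e2 := convMeasure_conv (totalJumpLaw p t) (jumpLaw p) hH (fun x => (hC x).1) x
    rw [Measure.conv_comm, convMeasure_conv _ _ hH (fun x => (hC x).1)] at e2
    rw [convMeasure, convMeasure, ← e2, ← integral_const_mul]
    rfl
  rw [e1]
  refine hs.congr_fun fun n => ?_
  exact congrArg _ (convMeasure_conv (jumpSumLaw p n) (jumpLaw p) hH (fun x => (hC x).1) x)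

lemma summable_natCast_mul_pow_div_factorial (b : ℝ) :
    Summable fun n : ℕ => (n : ℝ) * b ^ (n - 1) / (n.factorial : ℝ) := by
  rw [← summable_nat_add_iff 1]
  refine (Real.summable_pow_div_factorial b).congr fun n => ?_
  rw [Nat.factorial_succ]
  push_cast
  rw [mul_div_mul_left _ _ (by positivity)]

lemma IsHeatFunction.hasDerivAt_jumpEvolution_time (h : IsHeatFunction H H₁ H₂)
    (hp : IsJumpDensity p) {t : ℝ} (ht : 0 < t) (x : ℝ) :
    HasDerivAt (fun s => jumpEvolution p H s x) (freeOp p (jumpEvolution p H t) x) t := by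
  have := hp.isProbabilityMeasure_jumpSumLaw
  obtain ⟨C, hC⟩ := h.bound (t / 2) (2 * t) (by positivity)
  set A : ℕ → ℝ → ℝ := fun n s => convMeasure (jumpSumLaw p n) (H s) x with hA
  set A₂ : ℕ → ℝ → ℝ := fun n s => convMeasure (jumpSumLaw p n) (H₂ s) x with hA₂
  have hmem : t ∈ Set.Ioo (t / 2) (2 * t) := ⟨by linarith, by linarith⟩
  have hpos : ∀ s ∈ Set.Ioo (t / 2) (2 * t), 0 < s := fun s hs => by linarith [hs.1]
  have hbA : ∀ n, ∀ s ∈ Set.Ioo (t / 2) (2 * t), |A n s| ≤ C := fun n s hs =>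
    abs_convMeasure_le (fun x => (hC s ⟨hs.1.le, hs.2.le⟩ x).1) x
  have hbA₂ : ∀ n, ∀ s ∈ Set.Ioo (t / 2) (2 * t), |A₂ n s| ≤ C := fun n s hs =>
    abs_convMeasure_le (fun x => (hC s ⟨hs.1.le, hs.2.le⟩ x).2.2) x
  have hC0 : 0 ≤ C := (abs_nonneg _).trans (hbA 0 t hmem)
  have hd := hasDerivAt_tsum_of_isPreconnected (t := Set.Ioo (t / 2) (2 * t)) (y₀ := t) (y := t)
    (g := fun (n : ℕ) (s : ℝ) => s ^ n / (n.factorial : ℝ) * A n s)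
    (g' := fun (n : ℕ) (s : ℝ) => (n * s ^ (n - 1) / (n.factorial : ℝ)) * A n s +
      s ^ n / (n.factorial : ℝ) * (1 / 2 * A₂ n s))
    -- Majorant on the window: times are at most `2t`, and both convolutions are bounded by `C`
    -- uniformly in `n`.
    (u := fun n : ℕ => (n : ℝ) * (2 * t) ^ (n - 1) / (n.factorial : ℝ) * C +
      (2 * t) ^ n / (n.factorial : ℝ) * C)
    (((summable_natCast_mul_pow_div_factorial (2 * t)).mul_right C).add
      (summable_pow_div_factorial_mul (2 * t) C)) isOpen_Ioo isPreconnected_Ioo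
    (fun n s hs => ((hasDerivAt_pow n s).div_const _).mul
      ((h.conv (jumpSumLaw p n)).time s (hpos s hs) x)) ?_ hmem
    (h.hasSum_jumpEvolution hp ht x).summable hmem
  -- The term `n = 0` vanishes, and `(n + 1)/(n + 1)! = 1/n!` turns the shifted series into the gain
  -- term.
  · have hs1 : HasSum (fun n : ℕ => (n * t ^ (n - 1) / (n.factorial : ℝ)) * A n t)
        (convMeasure (jumpLaw p) (jumpEvolution p H t) x) := by
      rw [← hasSum_nat_add_iff' 1]
      simp only [Finset.range_one, Finset.sum_singleton, Nat.cast_zero, zero_mul, zero_div,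
        sub_zero]
      refine (h.hasSum_convMeasure_jumpLaw_jumpEvolution hp ht x).congr_fun fun n => ?_
      rw [Nat.factorial_succ]
      push_cast
      rw [mul_div_mul_left _ _ (by positivity)]
    obtain ⟨C', hC'⟩ := h.bound_at ht
    have hs2 := (hp.hasSum_exp_mul_convMeasure ht.le (h.continuous t ht)
      (fun x => (hC' x).2.2) x).mul_left (1 / 2)
    have hs := hs1.add hs2
    have e : ∑' n : ℕ, ((n * t ^ (n - 1) / (n.factorial : ℝ)) * A n t +
        t ^ n / (n.factorial : ℝ) * (1 / 2 * A₂ n t)) = freeOp p (jumpEvolution p H t) x := by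
      rw [freeOp, hp.integral_mul_jump, h.iteratedDeriv_jumpEvolution hp ht, add_comm]
      refine HasSum.tsum_eq (hs.congr_fun fun n => ?_)
      simp only [hA₂]
      ring
    rw [e] at hd
    refine hd.congr_of_eventuallyEq ?_
    filter_upwards [Ioi_mem_nhds ht] with s hs
    exact (h.hasSum_jumpEvolution hp hs x).tsum_eq.symm
  · intro n s hs
    have hs0 := (hpos s hs).le
    have hs2 := hs.2.le
    refine (norm_add_le _ _).trans ?_
    rw [norm_mul, norm_mul, norm_mul (1 / 2 : ℝ), 
      Real.norm_of_nonneg (by positivity : 0 ≤ (n : ℝ) * s ^ (n - 1) / (n.factorial : ℝ)),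
      Real.norm_of_nonneg (by positivity : 0 ≤ s ^ n / (n.factorial : ℝ)),
      Real.norm_of_nonneg (by norm_num : (0 : ℝ) ≤ 1 / 2)]
    have h1 := hbA n s hs
    have h2 : 1 / 2 * ‖A₂ n s‖ ≤ C := by
      have := hbA₂ n s hs
      rw [← Real.norm_eq_abs] at this
      linarith [norm_nonneg (A₂ n s)]
    gcongr
    exact h1

lemma IsHeatFunction.solvesFreeEvolution (h : IsHeatFunction H H₁ H₂) (hp : IsJumpDensity p) :
    SolvesFreeEvolution p (jumpEvolution p H) where
  contDiff _ ht := h.contDiff_jumpEvolution hp ht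
  integrable t ht y := by
    have := hp.isProbabilityMeasure_totalJumpLaw ht.le
    obtain ⟨C, hC⟩ := h.bound_at ht
    refine hp.integrable_mul_jump (h.contDiff_jumpEvolution hp ht).continuous
      (C := Real.exp t * C) (fun x => ?_) y
    rw [jumpEvolution, abs_mul, Real.abs_exp]
    gcongr
    exact abs_convMeasure_le (fun x => (hC x).1) x
  equation _ ht y := h.hasDerivAt_jumpEvolution_time hp ht y

end HeatFunctions

/-! ### Gaussian estimates -/

section HeatKernel

/-- The heat kernel of `½ ∂²`: the density of the Gaussian of variance `t`. -/
def heatKernel (t x : ℝ) : ℝ := (√(2 * Real.pi * t))⁻¹ * Real.exp (-(x ^ 2 / (2 * t)))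

/-- The spatial derivative of the heat kernel. -/
def heatKernel₁ (t x : ℝ) : ℝ := -(x / t) * heatKernel t x

/-- The second spatial derivative of the heat kernel. -/
def heatKernel₂ (t x : ℝ) : ℝ := (x ^ 2 / t ^ 2 - 1 / t) * heatKernel t x

lemma heatKernel_nonneg (t x : ℝ) : 0 ≤ heatKernel t x := by
  rw [heatKernel]
  positivity

lemma heatKernel_neg (t x : ℝ) : heatKernel t (-x) = heatKernel t x := by
  rw [heatKernel, heatKernel, neg_sq]

lemma gaussianPDFReal_eq_heatKernel {t : ℝ} (ht : 0 < t) (x : ℝ) :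
    gaussianPDFReal 0 t.toNNReal x = heatKernel t x := by
  rw [gaussianPDFReal, heatKernel, Real.coe_toNNReal _ ht.le, sub_zero, neg_div]

lemma continuous_heatKernel (t : ℝ) : Continuous (heatKernel t) := by
  unfold heatKernel
  fun_prop

lemma continuous_heatKernel₁ (t : ℝ) : Continuous (heatKernel₁ t) := by
  have := continuous_heatKernel t
  unfold heatKernel₁
  fun_prop

lemma continuous_heatKernel₂ (t : ℝ) : Continuous (heatKernel₂ t) := by
  have := continuous_heatKernel t
  unfold heatKernel₂
  fun_prop

lemma hasDerivAt_heatKernel (t x : ℝ) : HasDerivAt (heatKernel t) (heatKernel₁ t x) x := by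
  have h := (((hasDerivAt_pow 2 x).div_const (2 * t)).neg.exp).const_mul (√(2 * Real.pi * t))⁻¹
  refine h.congr_deriv ?_
  rw [heatKernel₁, heatKernel]
  simp only [Pi.neg_apply, Nat.cast_ofNat, Nat.add_one_sub_one, pow_one]
  rw [mul_div_mul_left _ _ (two_ne_zero)]
  ring

lemma hasDerivAt_heatKernel₁ (t x : ℝ) : HasDerivAt (heatKernel₁ t) (heatKernel₂ t x) x := by
  have h := ((hasDerivAt_id x).div_const t).neg.mul (hasDerivAt_heatKernel t x)
  refine h.congr_deriv ?_
  simp only [heatKernel₂, heatKernel₁, Pi.neg_apply, id]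
  ring

lemma hasDerivAt_heatKernel_time {t : ℝ} (ht : 0 < t) (x : ℝ) :
    HasDerivAt (fun s => heatKernel s x) (1 / 2 * heatKernel₂ t x) t := by
  have hpos : 0 < 2 * Real.pi * t := by positivity
  have hs : √(2 * Real.pi * t) ≠ 0 := (Real.sqrt_pos.2 hpos).ne'
  have h1 : HasDerivAt (fun s : ℝ => (√(2 * Real.pi * s))⁻¹)
      (-(1 / (2 * t)) * (√(2 * Real.pi * t))⁻¹) t := by
    have := (((hasDerivAt_id t).const_mul (2 * Real.pi)).sqrt hpos.ne').fun_inv hs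
    refine this.congr_deriv ?_
    rw [Real.sq_sqrt (by simpa using hpos.le)]
    simp only [id]
    field_simp
  have h2 : HasDerivAt (fun s : ℝ => Real.exp (-(x ^ 2 / (2 * s))))
      (Real.exp (-(x ^ 2 / (2 * t))) * (x ^ 2 / (2 * t ^ 2))) t := by
    have := ((((hasDerivAt_id t).const_mul 2).fun_inv (by simpa using ht.ne')).const_mul
      (x ^ 2)).fun_neg.exp
    refine this.congr_deriv ?_
    simp only [id]
    field_simp
  refine (h1.mul h2).congr_deriv ?_
  rw [heatKernel₂, heatKernel]
  field_simp
  ring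

lemma mul_exp_neg_le_one (y : ℝ) : y * Real.exp (-y) ≤ 1 := by
  rw [Real.exp_neg, mul_inv_le_iff₀ (Real.exp_pos y), one_mul]
  linarith [Real.add_one_le_exp y]

/-- Gaussian domination of the heat kernel and its derivatives, locally uniformly in time. -/
lemma exists_heatKernel_bound {a : ℝ} (b : ℝ) (ha : 0 < a) :
    ∃ M, 0 ≤ M ∧ ∀ t ∈ Set.Icc a b, ∀ x, |heatKernel t x| ≤ M * Real.exp (-(x ^ 2 / (4 * b))) ∧
      |heatKernel₁ t x| ≤ M * Real.exp (-(x ^ 2 / (4 * b))) ∧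
      |heatKernel₂ t x| ≤ M * Real.exp (-(x ^ 2 / (4 * b))) := by
  rcases lt_or_ge b a with hab | hab
  · exact ⟨0, le_rfl, fun t ht => absurd (ht.1.trans ht.2) (not_le.2 hab)⟩
  have hb : 0 < b := ha.trans_le hab
  set K := (√(2 * Real.pi * a))⁻¹ with hK
  have hK0 : 0 ≤ K := by positivity
  -- `K` bounds the normalising factor for times at least `a`; the summands of `L` serve the kernel
  -- and its two derivatives in turn.
  set L := 1 + (1 + 4 * b) / a + (4 * b / a ^ 2 + 1 / a) with hL
  have hL1 : 1 ≤ L := by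
    have : 0 ≤ (1 + 4 * b) / a + (4 * b / a ^ 2 + 1 / a) := by positivity
    linarith
  have hL2 : (1 + 4 * b) / a ≤ L := by
    have : 0 ≤ (4 * b / a ^ 2 + 1 / a) := by positivity
    linarith
  have hL3 : 4 * b / a ^ 2 + 1 / a ≤ L := by
    have : 0 ≤ (1 + 4 * b) / a := by positivity
    linarith
  refine ⟨K * L, by positivity, fun t ht x => ?_⟩
  have ht0 : 0 < t := ha.trans_le ht.1
  set E := Real.exp (-(x ^ 2 / (4 * b))) with hE
  have hE0 : 0 < E := Real.exp_pos _
  have hE1 : E ≤ 1 := Real.exp_le_one_iff.2 (by rw [neg_nonpos]; positivity)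
  have hx2 : x ^ 2 * E ≤ 4 * b := by
    have h := mul_exp_neg_le_one (x ^ 2 / (4 * b))
    rw [← hE, div_mul_eq_mul_div, div_le_one (by positivity)] at h
    exact h
  have hx1 : |x| * E ≤ 1 + 4 * b := by
    have : |x| ≤ 1 + x ^ 2 := by nlinarith [sq_abs x, sq_nonneg (|x| - 1)]
    nlinarith
  -- The Gaussian is split into two equal factors: one absorbs the polynomial prefactors, the other
  -- remains as the bound.
  have hk : heatKernel t x ≤ K * (E * E) := by
    rw [heatKernel, hE, ← Real.exp_add]
    have ht1 := ht.1
    have h2 : x ^ 2 / (2 * b) ≤ x ^ 2 / (2 * t) := by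
      have ht2 := ht.2
      gcongr
    refine mul_le_mul (by rw [hK]; gcongr) (Real.exp_le_exp.2 ?_) (Real.exp_pos _).le hK0
    have : x ^ 2 / (4 * b) + x ^ 2 / (4 * b) = x ^ 2 / (2 * b) := by field_simp; ring
    linarith
  have hk0 := heatKernel_nonneg t x
  refine ⟨?_, ?_, ?_⟩
  · rw [abs_of_nonneg hk0]
    calc heatKernel t x ≤ K * (E * E) := hk
      _ ≤ K * (L * E) := by gcongr; exact hE1.trans hL1
      _ = K * L * E := by ring
  · rw [heatKernel₁, abs_mul, abs_neg, abs_div, abs_of_pos ht0, abs_of_nonneg hk0]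
    calc |x| / t * heatKernel t x ≤ |x| / a * (K * (E * E)) := by
          gcongr
          exact ht.1
      _ = K * ((|x| * E) / a * E) := by ring
      _ ≤ K * (L * E) := by
          gcongr
          refine le_trans ?_ hL2
          gcongr
      _ = K * L * E := by ring
  · rw [heatKernel₂, abs_mul, abs_of_nonneg hk0]
    have h1 : |x ^ 2 / t ^ 2 - 1 / t| ≤ x ^ 2 / a ^ 2 + 1 / a := by
      refine (abs_sub _ _).trans ?_
      rw [abs_of_nonneg (by positivity), abs_of_nonneg (by positivity)]
      have ht1 := ht.1
      gcongr
    calc |x ^ 2 / t ^ 2 - 1 / t| * heatKernel t x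
        ≤ (x ^ 2 / a ^ 2 + 1 / a) * (K * (E * E)) := by gcongr
      _ = K * (((x ^ 2 * E) / a ^ 2 + 1 / a * E) * E) := by ring
      _ ≤ K * (L * E) := by
          gcongr
          refine le_trans ?_ hL3
          have : 1 / a * E ≤ 1 / a := mul_le_of_le_one_right (by positivity) hE1
          gcongr
      _ = K * L * E := by ring

lemma integrable_exp_neg_sq_div {b : ℝ} (hb : 0 < b) :
    Integrable fun x : ℝ => Real.exp (-(x ^ 2 / (4 * b))) := by
  refine (integrable_exp_neg_mul_sq (b := 1 / (4 * b)) (by positivity)).congr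
    (ae_of_all _ fun x => ?_)
  simp only
  congr 1
  ring

lemma exp_neg_sq_div_le_one {b : ℝ} (hb : 0 < b) (x : ℝ) :
    Real.exp (-(x ^ 2 / (4 * b))) ≤ 1 :=
  Real.exp_le_one_iff.2 (by rw [neg_nonpos]; positivity)

lemma isHeatFunction_heatKernel : IsHeatFunction heatKernel heatKernel₁ heatKernel₂ where
  hasDerivAt t _ x := hasDerivAt_heatKernel t x
  hasDerivAt' t _ x := hasDerivAt_heatKernel₁ t x
  continuous t _ := continuous_heatKernel₂ t
  time t ht x := hasDerivAt_heatKernel_time ht x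
  bound a b ha := by
    obtain ⟨M, hM, h⟩ := exists_heatKernel_bound b ha
    refine ⟨M, fun t ht x => ?_⟩
    obtain ⟨h0, h1, h2⟩ := h t ht x
    have hb : 0 < b := ha.trans_le (ht.1.trans ht.2)
    have := mul_le_of_le_one_right hM (exp_neg_sq_div_le_one hb x)
    exact ⟨h0.trans this, h1.trans this, h2.trans this⟩

lemma integral_gaussianReal_eq_heatKernel {t : ℝ} (ht : 0 < t) (f : ℝ → ℝ) :
    ∫ v, f v ∂(gaussianReal 0 t.toNNReal) = ∫ v, heatKernel t v * f v := by
  rw [integral_gaussianReal_eq_integral_smul (by simpa using ht)]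
  simp_rw [gaussianPDFReal_eq_heatKernel ht, smul_eq_mul]

lemma heatSemigroup_eq_integral_heatKernel {t : ℝ} (ht : 0 < t) {f : ℝ → ℝ} (hf : Continuous f)
    (x : ℝ) : heatSemigroup t f x = ∫ y, heatKernel t (x - y) * f y := by
  have h : heatSemigroup t f x = ∫ v, f (x + v) ∂(gaussianReal 0 t.toNNReal) := by
    rw [gaussianReal_zero_toNNReal ht.le, integral_map (by fun_prop) (by fun_prop)]
    rfl
  rw [h, integral_gaussianReal_eq_heatKernel ht, ← integral_sub_right_eq_self _ x]
  refine integral_congr_ae (ae_of_all _ fun y => ?_)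
  simp only
  rw [← heatKernel_neg, neg_sub, add_sub_cancel]

/-- Differentiation under the integral of a convolution with Gaussian domination. -/
lemma hasDerivAt_integral_mul_of_gaussian_bound {g g' f : ℝ → ℝ} (hg : ∀ x, HasDerivAt g (g' x) x)
    (hg' : Continuous g') {M b C : ℝ} (hb : 0 < b) (hM : 0 ≤ M)
    (h0 : ∀ x, |g x| ≤ M * Real.exp (-(x ^ 2 / (4 * b))))
    (h1 : ∀ x, |g' x| ≤ M * Real.exp (-(x ^ 2 / (4 * b)))) (hf : Continuous f)
    (hC : ∀ x, |f x| ≤ C) (x : ℝ) :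
    HasDerivAt (fun x => ∫ y, g (x - y) * f y) (∫ y, g' (x - y) * f y) x := by
  have hC0 : 0 ≤ C := (abs_nonneg _).trans (hC 0)
  have hgc : Continuous g := continuous_iff_continuousAt.2 fun x => (hg x).continuousAt
  have hint : Integrable fun y => M * Real.exp (-((x - y) ^ 2 / (4 * b))) * C :=
    (((integrable_exp_neg_sq_div hb).comp_sub_left x).const_mul M).mul_const C
  -- For `|z - x| < 1` one has `(x - y)² ≤ 2(z - y)² + 2`. A Gaussian centred at `z` is thus
  -- dominated by one centred at `x`, with `b` doubled and the extra factor `e^{1/(4b)}`.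
  have hint2 : Integrable fun y =>
      M * (Real.exp (1 / (4 * b)) * Real.exp (-((x - y) ^ 2 / (4 * (2 * b))))) * C :=
    ((((integrable_exp_neg_sq_div (b := 2 * b) (by positivity)).comp_sub_left x).const_mul
      _).const_mul M).mul_const C
  refine (hasDerivAt_integral_of_dominated_loc_of_deriv_le (μ := volume)
    (F := fun x y => g (x - y) * f y) (F' := fun x y => g' (x - y) * f y)
    (Metric.ball_mem_nhds x one_pos) (Eventually.of_forall fun y => by fun_prop) ?_ (by fun_prop)
    (ae_of_all _ fun y z hz => ?_) hint2
    (ae_of_all _ fun y z _ => ((hg (z - y)).comp_sub_const z y).mul_const _)).2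
  · refine hint.mono' (by fun_prop) (ae_of_all _ fun y => ?_)
    rw [norm_mul]
    exact mul_le_mul (h0 _) (hC y) (abs_nonneg _) (by positivity)
  · rw [norm_mul]
    refine mul_le_mul ((h1 _).trans ?_) (hC y) (abs_nonneg _) (by positivity)
    rw [← Real.exp_add]
    gcongr
    rw [Metric.mem_ball, Real.dist_eq] at hz
    have hz2 : (z - x) ^ 2 ≤ 1 := by
      rw [← sq_abs]
      nlinarith [abs_nonneg (z - x)]
    have : (x - y) ^ 2 ≤ 2 * (z - y) ^ 2 + 2 := by nlinarith [sq_nonneg ((z - y) + (z - x))]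
    rw [neg_le_iff_add_nonneg, ← sub_nonneg]
    have e : 1 / (4 * b) + -((x - y) ^ 2 / (4 * (2 * b))) + (z - y) ^ 2 / (4 * b) - 0 =
      (2 + 2 * (z - y) ^ 2 - (x - y) ^ 2) / (8 * b) := by
      field_simp
      ring
    rw [e]
    apply div_nonneg _ (by positivity)
    linarith

/-- The convolution of a bounded continuous function and the heat kernel (or its derivatives). -/
def heatConv (k : ℝ → ℝ → ℝ) (f : ℝ → ℝ) (t x : ℝ) : ℝ := ∫ y, k t (x - y) * f y

lemma abs_integral_mul_le_of_gaussian_bound {g f : ℝ → ℝ} {M b C : ℝ} (hb : 0 < b)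
    (hM : 0 ≤ M) (h0 : ∀ x, |g x| ≤ M * Real.exp (-(x ^ 2 / (4 * b)))) (hC : ∀ x, |f x| ≤ C)
    (x : ℝ) :
    |∫ y, g (x - y) * f y| ≤ ∫ y, M * Real.exp (-(y ^ 2 / (4 * b))) * C := by
  rw [← integral_sub_left_eq_self (fun y => M * Real.exp (-(y ^ 2 / (4 * b))) * C) volume x,
    ← Real.norm_eq_abs]
  refine norm_integral_le_of_norm_le
    ((((integrable_exp_neg_sq_div hb).comp_sub_left x).const_mul M).mul_const C)
    (ae_of_all _ fun y => ?_)
  rw [norm_mul]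
  exact mul_le_mul (h0 _) (hC y) (abs_nonneg _) (by positivity)

lemma isHeatFunction_heatConv {f : ℝ → ℝ} (hf : Continuous f) {C : ℝ} (hC : ∀ x, |f x| ≤ C) :
    IsHeatFunction (heatConv heatKernel f) (heatConv heatKernel₁ f) (heatConv heatKernel₂ f) where
  hasDerivAt t ht x := by
    obtain ⟨M, hM, h⟩ := exists_heatKernel_bound t ht
    have h := h t ⟨le_rfl, le_rfl⟩
    exact hasDerivAt_integral_mul_of_gaussian_bound (hasDerivAt_heatKernel t)
      (continuous_heatKernel₁ t) ht hM (fun x => (h x).1) (fun x => (h x).2.1) hf hC x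
  hasDerivAt' t ht x := by
    obtain ⟨M, hM, h⟩ := exists_heatKernel_bound t ht
    have h := h t ⟨le_rfl, le_rfl⟩
    exact hasDerivAt_integral_mul_of_gaussian_bound (hasDerivAt_heatKernel₁ t)
      (continuous_heatKernel₂ t) ht hM (fun x => (h x).2.1) (fun x => (h x).2.2) hf hC x
  continuous t ht := by
    obtain ⟨M, hM, h⟩ := exists_heatKernel_bound t ht
    have h := h t ⟨le_rfl, le_rfl⟩
    have hk := continuous_heatKernel₂ t
    -- Moving `x` into the bounded factor `f` makes the dominating function independent of `x`.
    have e : heatConv heatKernel₂ f t = fun x => ∫ u, heatKernel₂ t u * f (x - u) := by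
      ext x
      rw [heatConv, ← integral_sub_left_eq_self _ volume x]
      simp_rw [sub_sub_cancel]
    rw [e]
    refine continuous_of_dominated (bound := fun u => M * Real.exp (-(u ^ 2 / (4 * t))) * C)
      (fun x => by fun_prop) (fun x => ae_of_all _ fun u => ?_)
      (((integrable_exp_neg_sq_div ht).const_mul M).mul_const C) (ae_of_all _ fun u => by fun_prop)
    rw [norm_mul]
    exact mul_le_mul (h u).2.2 (hC _) (abs_nonneg _) (by positivity)
  time t ht x := by
    have hC0 : 0 ≤ C := (abs_nonneg _).trans (hC 0)
    obtain ⟨M, hM, h⟩ := exists_heatKernel_bound (a := t / 2) (2 * t) (by positivity)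
    have hmem : Set.Icc (t / 2) (2 * t) ∈ 𝓝 t := Icc_mem_nhds (by linarith) (by linarith)
    have hpos : ∀ s ∈ Set.Icc (t / 2) (2 * t), 0 < s := fun s hs => by linarith [hs.1]
    have hint : Integrable fun y => M * Real.exp (-((x - y) ^ 2 / (4 * (2 * t)))) * C :=
      (((integrable_exp_neg_sq_div (b := 2 * t) (by positivity)).comp_sub_left x).const_mul
        M).mul_const C
    have hk := continuous_heatKernel₂ t
    have hd := (hasDerivAt_integral_of_dominated_loc_of_deriv_le (μ := volume)
      (F := fun s y => heatKernel s (x - y) * f y)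
      (F' := fun s y => 1 / 2 * heatKernel₂ s (x - y) * f y) (x₀ := t) hmem
      (Eventually.of_forall fun s => ?_) ?_ (by fun_prop) (ae_of_all _ fun y s hs => ?_) hint
      (ae_of_all _ fun y s hs => (hasDerivAt_heatKernel_time (hpos s hs) _).mul_const _)).2
    · simp_rw [mul_assoc] at hd
      rwa [integral_const_mul] at hd
    · have := continuous_heatKernel s
      fun_prop
    · have := continuous_heatKernel t
      refine hint.mono' (by fun_prop) (ae_of_all _ fun y => ?_)
      rw [norm_mul]
      exact mul_le_mul (h t (mem_of_mem_nhds hmem) _).1 (hC y) (abs_nonneg _) (by positivity)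
    · rw [norm_mul]
      refine mul_le_mul ?_ (hC y) (abs_nonneg _) (by positivity)
      have := (h s hs (x - y)).2.2
      rw [norm_mul, Real.norm_eq_abs, Real.norm_eq_abs, abs_of_pos (by norm_num : (0 : ℝ) < 1 / 2)]
      linarith [abs_nonneg (heatKernel₂ s (x - y))]
  bound a b ha := by
    obtain ⟨M, hM, h⟩ := exists_heatKernel_bound b ha
    refine ⟨∫ y, M * Real.exp (-(y ^ 2 / (4 * b))) * C, fun t ht x => ?_⟩
    have hb : 0 < b := ha.trans_le (ht.1.trans ht.2)
    exact ⟨abs_integral_mul_le_of_gaussian_bound hb hM (fun x => (h t ht x).1) hC x,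
      abs_integral_mul_le_of_gaussian_bound hb hM (fun x => (h t ht x).2.1) hC x,
      abs_integral_mul_le_of_gaussian_bound hb hM (fun x => (h t ht x).2.2) hC x⟩

end HeatKernel

/-! ### Maximum principle and uniqueness -/

section Uniqueness

variable {p : ℝ → ℝ → ℝ}

/-- At a maximum the first derivative vanishes, so Taylor's formula gives `g'' ≤ 0` at intermediate
points that converge to `y`. -/
lemma iteratedDeriv_two_nonpos_of_forall_le {g : ℝ → ℝ} (hg : ContDiff ℝ 2 g) {y : ℝ}
    (h : ∀ x, g x ≤ g y) : iteratedDeriv 2 g y ≤ 0 := by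
  have hd : deriv g y = 0 := IsLocalMax.deriv_eq_zero (Eventually.of_forall h)
  choose ξ h1 h2 using exists_taylor_two hg y
  have hξ : Tendsto ξ (𝓝[>] 0) (𝓝 y) := by
    rw [tendsto_iff_norm_sub_tendsto_zero]
    have : Tendsto (fun t : ℝ => |t|) (𝓝[>] 0) (𝓝 0) := by
      simpa using (continuous_abs.tendsto (0 : ℝ)).mono_left nhdsWithin_le_nhds
    exact squeeze_zero (fun t => norm_nonneg _) h1 this
  refine le_of_tendsto (((hg.continuous_iteratedDeriv 2 le_rfl).tendsto y).comp hξ) ?_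
  filter_upwards [self_mem_nhdsWithin] with t (ht : 0 < t)
  have h3 := h (y + t)
  rw [h2 t, hd] at h3
  have h4 : iteratedDeriv 2 g (ξ t) * t ^ 2 ≤ 0 := by linarith
  exact nonpos_of_mul_nonpos_left h4 (by positivity)

lemma HasDerivAt.nonneg_of_forall_lt_le {f : ℝ → ℝ} {d a t : ℝ} (hf : HasDerivAt f d t)
    (hat : a < t) (h : ∀ s, a < s → s < t → f s ≤ f t) : 0 ≤ d := by
  have hs := (hasDerivAt_iff_tendsto_slope.1 hf).mono_left
    (nhdsWithin_mono (s := Set.Iio t) _ fun s (hs : s < t) => hs.ne)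
  refine ge_of_tendsto hs ?_
  filter_upwards [Ioo_mem_nhdsLT hat] with s hs
  rw [slope_def_field]
  exact div_nonneg_of_nonpos (by linarith [h s hs.1 hs.2]) (by linarith [hs.2])

/-- The maximum principle: at a point where `u` touches the barrier `m (1 + y²) e^{λ t}` from
below, `u` could not have reached the barrier. -/
lemma SolvesFreeEvolution.not_touches_barrier (hp : IsJumpDensity p) {ξ : ℝ}
    (hξ : ∀ z, ξ ≤ |z| → p 0 z = 0) {u : ℝ → ℝ → ℝ} (hu : SolvesFreeEvolution p u) {m t y : ℝ}
    (hm : 0 < m) (ht : 0 < t)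
    (hle : ∀ s, 0 < s → s ≤ t → ∀ z, u s z ≤ m * (1 + z ^ 2) * Real.exp ((3 + 2 * ξ ^ 2) * s)) :
    u t y ≠ m * (1 + y ^ 2) * Real.exp ((3 + 2 * ξ ^ 2) * t) := by
  intro heq
  -- This rate makes the barrier a strict supersolution: `(1 + y²)L` exceeds `1 + (1 + 2y² + 2ξ²)`,
  -- the sum of the diffusion and jump bounds below, by `1 + y² + 2ξ²y²`.
  set L := 3 + 2 * ξ ^ 2 with hL
  set E := Real.exp (L * t) with hE
  have hE0 : 0 < E := Real.exp_pos _
  -- The difference with the barrier is nonpositive before `t` and zero at `t`, so its time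
  -- derivative is nonnegative there.
  have htime : 0 ≤ freeOp p (u t) y - m * (1 + y ^ 2) * (E * L) := by
    have h1 : HasDerivAt (fun s => u s y - m * (1 + y ^ 2) * Real.exp (L * s))
        (freeOp p (u t) y - m * (1 + y ^ 2) * (E * L)) t := by
      refine (hu.equation t ht y).sub ?_
      have := ((hasDerivAt_id t).const_mul L).exp.const_mul (m * (1 + y ^ 2))
      simpa using this
    refine HasDerivAt.nonneg_of_forall_lt_le h1 ht fun s hs0 hst => ?_
    have h2 := hle s hs0 hst.le y
    linarith
  have hspace : iteratedDeriv 2 (u t) y ≤ 2 * m * E := by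
    have hq : ∀ z, HasDerivAt (fun z : ℝ => m * (1 + z ^ 2) * E) (2 * m * E * z) z := fun z => by
      have := (((hasDerivAt_pow 2 z).const_add 1).const_mul m).mul_const E
      refine this.congr_deriv ?_
      simp
      ring
    have hqc : ContDiff ℝ 2 fun z : ℝ => m * (1 + z ^ 2) * E := by fun_prop
    have hq2 : iteratedDeriv 2 (fun z : ℝ => m * (1 + z ^ 2) * E) y = 2 * m * E := by
      rw [iteratedDeriv_succ, iteratedDeriv_one, funext fun z => (hq z).deriv]
      simp
    have h1 := iteratedDeriv_two_nonpos_of_forall_le (y := y) ((hu.contDiff t ht).sub hqc)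
      fun z => by
        have := hle t ht le_rfl z
        linarith
    rw [iteratedDeriv_fun_sub (hu.contDiff t ht).contDiffAt hqc.contDiffAt, hq2] at h1
    linarith
  -- Only `|y - z| < ξ` matters, and there `z² ≤ 2y² + 2ξ²`; finite range is what controls the
  -- quadratic growth.
  have hint : ∫ z, u t z * p z y ≤ m * E * (1 + 2 * y ^ 2 + 2 * ξ ^ 2) := by
    have hpi : ∫ z, p z y = 1 := by
      simp_rw [fun z => hp.translation z y]
      rw [integral_sub_left_eq_self (fun z => p 0 z), hp.integral_eq_one]
    have hpint : Integrable fun z => p z y := by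
      simp_rw [fun z => hp.translation z y]
      exact hp.integrable.comp_sub_left y
    calc ∫ z, u t z * p z y ≤ ∫ z, m * E * (1 + 2 * y ^ 2 + 2 * ξ ^ 2) * p z y := by
          refine integral_mono (hu.integrable t ht y) (hpint.const_mul _) fun z => ?_
          simp only
          rw [hp.translation z y]
          rcases le_or_gt ξ |y - z| with h | h
          · rw [hξ _ h, mul_zero, mul_zero]
          · refine mul_le_mul_of_nonneg_right ((hle t ht le_rfl z).trans ?_) (hp.nonneg _)
            have h1 : (y - z) ^ 2 ≤ ξ ^ 2 := by
              rw [← sq_abs (y - z)]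
              gcongr
            have h2 : 1 + z ^ 2 ≤ 1 + 2 * y ^ 2 + 2 * ξ ^ 2 := by
              nlinarith [sq_nonneg (y + (y - z))]
            calc m * (1 + z ^ 2) * E = m * E * (1 + z ^ 2) := by ring
              _ ≤ _ := by gcongr
      _ = _ := by rw [integral_const_mul, hpi, mul_one]
  have hmE : 0 < m * E := by positivity
  rw [freeOp] at htime
  have h1 : 0 ≤ m * E * (1 + (1 + 2 * y ^ 2 + 2 * ξ ^ 2) - (1 + y ^ 2) * L) := by linarith
  have h2 := nonneg_of_mul_nonneg_right h1 hmE
  nlinarith [mul_nonneg (sq_nonneg y) (sq_nonneg ξ), sq_nonneg y]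

/-- If `u` is positive somewhere, its quotient by `(1 + y²) e^{Lt}` attains a positive maximum,
because bounded `u` makes the quotient small far away. Taking that maximum as `m` gives a barrier
which `u` touches, and this is impossible. -/
lemma SolvesFreeEvolution.nonpos (hp : IsJumpDensity p) {u : ℝ → ℝ → ℝ}
    (hu : SolvesFreeEvolution p u)
    (hcont : ContinuousOn (fun q : ℝ × ℝ => u q.1 q.2) (Set.Ici 0 ×ˢ Set.univ))
    (hbdd : ∀ T : ℝ, ∃ C : ℝ, ∀ t, 0 ≤ t → t ≤ T → ∀ y, |u t y| ≤ C)
    (h0 : ∀ y, u 0 y ≤ 0) {t : ℝ} (ht : 0 ≤ t) (y : ℝ) : u t y ≤ 0 := by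
  by_contra! hpos
  obtain ⟨ξ, -, hξ⟩ := hp.finite_range
  obtain ⟨C, hC⟩ := hbdd t
  have hCpos : 0 < C := hpos.trans_le ((le_abs_self _).trans (hC t ht le_rfl y))
  set L := 3 + 2 * ξ ^ 2 with hL
  have hL0 : 0 < L := by positivity
  set v : ℝ × ℝ → ℝ := fun q => u q.1 q.2 / ((1 + q.2 ^ 2) * Real.exp (L * q.1)) with hv
  have hden : ∀ q : ℝ × ℝ, 0 < (1 + q.2 ^ 2) * Real.exp (L * q.1) := fun q => by positivity
  have hvpos : 0 < v (t, y) := div_pos hpos (hden (t, y))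
  -- For `|z| > R`, `1 + z² ≥ |z| ≥ C / v(t, y)`, so the quotient is at most `v(t, y)`; the `|y|`
  -- keeps `(t, y)` inside the compact set.
  set R := |y| + C / v (t, y) with hR
  have hRC : 0 ≤ C / v (t, y) := by positivity
  have hvcont : ContinuousOn v (Set.Icc 0 t ×ˢ Set.Icc (-R) R) := by
    refine ContinuousOn.div (hcont.mono (Set.prod_mono (fun s hs => hs.1) (Set.subset_univ _)))
      (by fun_prop) fun q _ => (hden q).ne'
  have hmemK : (t, y) ∈ Set.Icc 0 t ×ˢ Set.Icc (-R) R := by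
    refine ⟨⟨ht, le_rfl⟩, abs_le.1 ?_⟩
    simp only [hR]
    linarith
  obtain ⟨⟨t₀, y₀⟩, ⟨⟨ht₀, ht₀'⟩, -⟩, hmax⟩ :=
    (isCompact_Icc.prod isCompact_Icc).exists_isMaxOn ⟨_, hmemK⟩ hvcont
  simp only at ht₀ ht₀'
  have hm : 0 < v (t₀, y₀) := hvpos.trans_le (hmax hmemK)
  have hglob : ∀ s, 0 ≤ s → s ≤ t → ∀ z, v (s, z) ≤ v (t₀, y₀) := by
    intro s hs0 hst z
    by_cases hz : |z| ≤ R
    · exact hmax ⟨⟨hs0, hst⟩, abs_le.1 hz⟩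
    · push Not at hz
      refine le_trans ?_ (hmax hmemK)
      have hz1 : C / v (t, y) ≤ 1 + z ^ 2 := by
        have : |z| ≤ 1 + z ^ 2 := by nlinarith [sq_abs z, sq_nonneg (|z| - 1)]
        linarith [abs_nonneg y]
      rw [div_le_iff₀ hvpos] at hz1
      rw [hv]
      simp only
      rw [div_le_iff₀ (hden (s, z))]
      have he : 1 ≤ Real.exp (L * s) := Real.one_le_exp (by positivity)
      have h1 : (1 + z ^ 2) * 1 ≤ (1 + z ^ 2) * Real.exp (L * s) := by gcongr
      calc u s z ≤ C := (le_abs_self _).trans (hC s hs0 hst z)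
        _ ≤ v (t, y) * ((1 + z ^ 2) * 1) := by linarith
        _ ≤ v (t, y) * ((1 + z ^ 2) * Real.exp (L * s)) := by gcongr
  have ht₀pos : 0 < t₀ := by
    refine lt_of_le_of_ne ht₀ fun h => ?_
    rw [← h] at hm
    exact absurd hm (not_lt.2 (div_nonpos_of_nonpos_of_nonneg (h0 y₀) (hden (0, y₀)).le))
  refine hu.not_touches_barrier hp hξ hm ht₀pos (y := y₀) (fun s hs hst z => ?_) ?_
  · have := hglob s hs.le (hst.trans ht₀') z
    rw [hv] at this
    simp only at this
    rw [div_le_iff₀ (hden (s, z))] at this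
    rw [mul_assoc]
    exact this
  · rw [mul_assoc]
    exact (div_mul_cancel₀ _ (hden (t₀, y₀)).ne').symm

lemma SolvesFreeEvolution.sub {u v : ℝ → ℝ → ℝ} (hu : SolvesFreeEvolution p u)
    (hv : SolvesFreeEvolution p v) : SolvesFreeEvolution p (fun t y => u t y - v t y) where
  contDiff t ht := (hu.contDiff t ht).sub (hv.contDiff t ht)
  integrable t ht y := by
    simp_rw [sub_mul]
    exact (hu.integrable t ht y).sub (hv.integrable t ht y)
  equation t ht y := by
    refine ((hu.equation t ht y).sub (hv.equation t ht y)).congr_deriv ?_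
    simp_rw [freeOp, sub_mul]
    rw [integral_sub (hu.integrable t ht y) (hv.integrable t ht y)]
    have := iteratedDeriv_sub (hu.contDiff t ht).contDiffAt (hv.contDiff t ht).contDiffAt (x := y)
    rw [show (fun y => u t y - v t y) = u t - v t from rfl, this]
    ring

lemma IsSolutionFrom.le (hp : IsJumpDensity p) {ρ₀ : ℝ → ℝ} {ρ σ : ℝ → ℝ → ℝ}
    (hρ : IsSolutionFrom p ρ₀ ρ) (hσ : IsSolutionFrom p ρ₀ σ) {t : ℝ} (ht : 0 ≤ t) (y : ℝ) :
    ρ t y ≤ σ t y := by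
  refine sub_nonpos.1 ((hρ.solves.sub hσ.solves).nonpos hp (hρ.continuousOn.sub hσ.continuousOn)
    (fun T => ?_) (fun y => ?_) ht y)
  · obtain ⟨C, hC⟩ := hρ.bounded T
    obtain ⟨D, hD⟩ := hσ.bounded T
    exact ⟨C + D, fun t ht hT y => (abs_sub _ _).trans (add_le_add (hC t ht hT y) (hD t ht hT y))⟩
  · rw [hρ.initial, hσ.initial, sub_self]

lemma IsSolutionFrom.unique (hp : IsJumpDensity p) {ρ₀ : ℝ → ℝ} {ρ σ : ℝ → ℝ → ℝ}
    (hρ : IsSolutionFrom p ρ₀ ρ) (hσ : IsSolutionFrom p ρ₀ σ) {t : ℝ} (ht : 0 ≤ t) (y : ℝ) :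
    ρ t y = σ t y :=
  le_antisymm (hρ.le hp hσ ht y) (hσ.le hp hρ ht y)

end Uniqueness

/-! ### Smooth transition densities and duality -/

section Kernel

/-- Derivatives fall on `f`. The induction runs over all `f` with bounded derivatives, a class
stable under differentiation. -/
lemma contDiff_convMeasure (μ : Measure ℝ) [IsFiniteMeasure μ] (n : ℕ) {f : ℝ → ℝ}
    (hf : ContDiff ℝ ∞ f) (hb : ∀ k, ∃ C, ∀ x, |iteratedDeriv k f x| ≤ C) :
    ContDiff ℝ n (convMeasure μ f) := by
  induction n generalizing f with
  | zero =>
    obtain ⟨C, hC⟩ := hb 0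
    rw [iteratedDeriv_zero] at hC
    exact contDiff_zero.2 (continuous_convMeasure μ hf.continuous hC)
  | succ n ih =>
    obtain ⟨C, hC⟩ := hb 0
    obtain ⟨C', hC'⟩ := hb 1
    rw [iteratedDeriv_zero] at hC
    rw [iteratedDeriv_one] at hC'
    have hf' := contDiff_infty_iff_deriv.1 hf
    have hd := hasDerivAt_convMeasure μ (fun x => (hf'.1 x).hasDerivAt) hf'.2.continuous hC hC'
    push_cast
    rw [contDiff_succ_iff_deriv]
    refine ⟨fun x => (hd x).differentiableAt, by simp, ?_⟩
    rw [funext fun x => (hd x).deriv]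
    refine ih hf'.2 fun k => ?_
    rw [← iteratedDeriv_succ']
    exact hb (k + 1)

lemma contDiff_heatKernel (t : ℝ) : ContDiff ℝ ∞ (heatKernel t) := by
  unfold heatKernel
  fun_prop

lemma exists_iteratedDeriv_heatKernel_eq (t : ℝ) (k : ℕ) :
    ∃ P : Polynomial ℝ, iteratedDeriv k (heatKernel t) = fun x => P.eval x * heatKernel t x := by
  induction k with
  | zero => exact ⟨1, by simp⟩
  | succ k ih =>
    obtain ⟨P, hP⟩ := ih
    refine ⟨Polynomial.derivative P - Polynomial.C t⁻¹ * Polynomial.X * P, ?_⟩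
    rw [iteratedDeriv_succ, hP]
    ext x
    rw [((P.hasDerivAt x).fun_mul (hasDerivAt_heatKernel t x)).deriv, heatKernel₁]
    simp
    ring

lemma exists_pow_mul_heatKernel_le {t : ℝ} (ht : 0 < t) (n : ℕ) :
    ∃ C, ∀ x, |x ^ n * heatKernel t x| ≤ C := by
  set K := (√(2 * Real.pi * t))⁻¹ with hK
  have hK0 : 0 ≤ K := by positivity
  -- Use `|x^n| ≤ 1 + (x²)^n` and `r^n / n! ≤ e^r` at `r = x²/(2t)`.
  refine ⟨K * (1 + (2 * t) ^ n * n.factorial), fun x => ?_⟩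
  set E := Real.exp (-(x ^ 2 / (2 * t))) with hE
  have hE0 : 0 < E := Real.exp_pos _
  have hE1 : E ≤ 1 := Real.exp_le_one_iff.2 (by rw [neg_nonpos]; positivity)
  have h1 : |x ^ n| ≤ 1 + (x ^ 2) ^ n := by
    rw [← pow_mul, mul_comm 2 n, pow_mul]
    nlinarith [sq_abs (x ^ n), sq_nonneg (|x ^ n| - 1), abs_nonneg (x ^ n)]
  have h2 : (x ^ 2) ^ n * E ≤ (2 * t) ^ n * n.factorial := by
    have h := Real.pow_div_factorial_le_exp (x ^ 2 / (2 * t)) (by positivity) n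
    rw [div_pow, div_div, div_le_iff₀ (by positivity)] at h
    calc (x ^ 2) ^ n * E ≤ (Real.exp (x ^ 2 / (2 * t)) * ((2 * t) ^ n * n.factorial)) * E := by
          gcongr
      _ = (2 * t) ^ n * n.factorial * (Real.exp (x ^ 2 / (2 * t)) * E) := by ring
      _ = _ := by rw [hE, ← Real.exp_add, add_neg_cancel, Real.exp_zero, mul_one]
  rw [abs_mul, abs_of_nonneg (heatKernel_nonneg t x)]
  calc |x ^ n| * heatKernel t x ≤ (1 + (x ^ 2) ^ n) * heatKernel t x :=
        mul_le_mul_of_nonneg_right h1 (heatKernel_nonneg t x)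
    _ = K * (E + (x ^ 2) ^ n * E) := by rw [heatKernel]; ring
    _ ≤ _ := by gcongr

lemma exists_iteratedDeriv_heatKernel_le {t : ℝ} (ht : 0 < t) (k : ℕ) :
    ∃ C, ∀ x, |iteratedDeriv k (heatKernel t) x| ≤ C := by
  obtain ⟨P, hP⟩ := exists_iteratedDeriv_heatKernel_eq t k
  simp only [hP]
  clear hP
  induction P using Polynomial.induction_on' with
  | add P Q hP hQ =>
    obtain ⟨C, hC⟩ := hP
    obtain ⟨D, hD⟩ := hQ
    refine ⟨C + D, fun x => ?_⟩
    rw [Polynomial.eval_add, add_mul]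
    exact (abs_add_le _ _).trans (add_le_add (hC x) (hD x))
  | monomial n a =>
    obtain ⟨C, hC⟩ := exists_pow_mul_heatKernel_le ht n
    refine ⟨|a| * C, fun x => ?_⟩
    rw [Polynomial.eval_monomial, mul_assoc, abs_mul]
    exact mul_le_mul_of_nonneg_left (hC x) (abs_nonneg a)

variable {p : ℝ → ℝ → ℝ}

/-- The transition density of the Brownian motion with jumps. -/
def jumpKernel (p : ℝ → ℝ → ℝ) (t x y : ℝ) : ℝ :=
  convMeasure (totalJumpLaw p t) (heatKernel t) (y - x)

lemma exp_mul_jumpKernel (t x y : ℝ) :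
    Real.exp t * jumpKernel p t x y = jumpEvolution p heatKernel t (y - x) := rfl

lemma integrable_heatKernel {t : ℝ} (ht : 0 < t) : Integrable (heatKernel t) := by
  simpa [funext fun x => gaussianPDFReal_eq_heatKernel ht x] using
    integrable_gaussianPDFReal 0 t.toNNReal

lemma integrable_prod_heatKernel (μ : Measure ℝ) [IsFiniteMeasure μ] {t : ℝ} (ht : 0 < t) (x : ℝ) :
    Integrable (fun q : ℝ × ℝ => heatKernel t (q.2 - x - q.1)) (μ.prod volume) := by
  have hc := continuous_heatKernel t
  rw [integrable_prod_iff (by fun_prop)]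
  refine ⟨ae_of_all _ fun w => ((integrable_heatKernel ht).comp_sub_right w).comp_sub_right x, ?_⟩
  have : (fun w => ∫ y, ‖heatKernel t (y - x - w)‖) = fun _ => ∫ y, ‖heatKernel t y‖ := by
    ext w
    rw [integral_sub_right_eq_self (fun y => ‖heatKernel t (y - w)‖) x,
      integral_sub_right_eq_self (fun y => ‖heatKernel t y‖) w]
  simp only [this]
  exact integrable_const _

lemma IsJumpDensity.integrable_jumpKernel (hp : IsJumpDensity p) {t : ℝ} (ht : 0 < t) (x : ℝ) :
    Integrable fun y => jumpKernel p t x y := by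
  have := hp.isProbabilityMeasure_totalJumpLaw ht.le
  exact (integrable_prod_heatKernel (totalJumpLaw p t) ht x).integral_prod_right

/-- Fubini over the jump displacement and the endpoint, with evenness of the heat kernel to match
the arguments. -/
lemma IsJumpDensity.semigroup_eq_integral_jumpKernel (hp : IsJumpDensity p) {t : ℝ} (ht : 0 < t)
    {f : ℝ → ℝ} (hf : Continuous f) {C : ℝ} (hC : ∀ x, |f x| ≤ C) (x : ℝ) :
    semigroup p t f x = ∫ y, jumpKernel p t x y * f y := by
  have := hp.isProbabilityMeasure_totalJumpLaw ht.le
  have hint : Integrable (fun q : ℝ × ℝ => heatKernel t (q.2 - x - q.1) * f q.2)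
      ((totalJumpLaw p t).prod volume) :=
    (integrable_prod_heatKernel (totalJumpLaw p t) ht x).mul_bdd (c := C) (by fun_prop)
      (ae_of_all _ fun q => hC _)
  calc semigroup p t f x = ∫ w, heatSemigroup t f (x + w) ∂(totalJumpLaw p t) :=
        hp.semigroup_eq_integral_integral ht.le hf hC x
    _ = ∫ w, (∫ y, heatKernel t (y - x - w) * f y) ∂(totalJumpLaw p t) := by
        refine integral_congr_ae (ae_of_all _ fun w => ?_)
        simp only
        rw [heatSemigroup_eq_integral_heatKernel ht hf]
        refine integral_congr_ae (ae_of_all _ fun y => ?_)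
        simp only
        rw [← heatKernel_neg]
        congr 2
        ring
    _ = ∫ y, (∫ w, heatKernel t (y - x - w) * f y ∂(totalJumpLaw p t)) :=
        integral_integral_swap hint
    _ = _ := by
        simp_rw [integral_mul_const]
        rfl

lemma IsJumpDensity.isSmoothKernel_jumpKernel (hp : IsJumpDensity p) :
    IsSmoothKernel p (jumpKernel p) where
  nonneg t _ x y := integral_nonneg fun w => heatKernel_nonneg _ _
  integrable _ ht x := hp.integrable_jumpKernel ht x
  kernel _ ht f x := hp.semigroup_eq_integral_jumpKernel ht f.continuous f.norm_coe_le_norm x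
  smooth t ht := by
    have := hp.isProbabilityMeasure_totalJumpLaw ht.le
    have h : ContDiff ℝ ∞ (convMeasure (totalJumpLaw p t) (heatKernel t)) :=
      contDiff_infty.2 fun n => contDiff_convMeasure _ n (contDiff_heatKernel t)
        (exists_iteratedDeriv_heatKernel_le ht)
    exact h.comp (contDiff_snd.sub contDiff_fst)
  differentiable_time t ht x y := by
    have h := (isHeatFunction_heatKernel.hasDerivAt_jumpEvolution_time hp ht
      (y - x)).differentiableAt
    -- Time regularity is inherited from the free evolution by undoing the factor `e^s`.
    have he : (fun s => jumpKernel p s x y) =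
        fun s => Real.exp (-s) * jumpEvolution p heatKernel s (y - x) := by
      ext s
      rw [← exp_mul_jumpKernel, ← mul_assoc, ← Real.exp_add, neg_add_cancel, Real.exp_zero, one_mul]
    rw [he]
    fun_prop

lemma IsJumpDensity.convMeasure_jumpSumLaw_adj (hp : IsJumpDensity p) (n : ℕ) {f : ℝ → ℝ}
    (hf : Continuous f) (x : ℝ) :
    convMeasure (jumpSumLaw (JumpBM.adj p) n) f x = ∫ w, f (x + w) ∂(jumpSumLaw p n) := by
  rw [convMeasure, hp.jumpSumLaw_adj, integral_map (by fun_prop) (by fun_prop)]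
  simp_rw [sub_neg_eq_add]

lemma IsJumpDensity.convMeasure_totalJumpLaw_adj (hp : IsJumpDensity p) {t : ℝ} (ht : 0 ≤ t)
    {f : ℝ → ℝ} (hf : Continuous f) {C : ℝ} (hC : ∀ x, |f x| ≤ C) (x : ℝ) :
    convMeasure (totalJumpLaw (JumpBM.adj p) t) f x = ∫ w, f (x + w) ∂(totalJumpLaw p t) := by
  have h1 := hp.adj.hasSum_integral_totalJumpLaw ht (f := fun w => f (x - w)) (by fun_prop)
    (fun w => hC _)
  have h2 := hp.hasSum_integral_totalJumpLaw ht (f := fun w => f (x + w)) (by fun_prop)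
    (fun w => hC _)
  refine h1.unique (h2.congr_fun fun n => ?_)
  rw [← hp.convMeasure_jumpSumLaw_adj n hf]
  rfl

/-- Exchanging the endpoints flips the argument of the even heat kernel, and reversing the jumps
flips the sign of `w`; the two effects cancel. -/
lemma IsJumpDensity.jumpKernel_adj (hp : IsJumpDensity p) {t : ℝ} (ht : 0 < t) (x y : ℝ) :
    jumpKernel (JumpBM.adj p) t y x = jumpKernel p t x y := by
  obtain ⟨C, hC⟩ := isHeatFunction_heatKernel.bound_at ht
  rw [jumpKernel, hp.convMeasure_totalJumpLaw_adj ht.le (continuous_heatKernel t)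
    (fun x => (hC x).1), jumpKernel, convMeasure]
  refine integral_congr_ae (ae_of_all _ fun w => ?_)
  simp only
  rw [← heatKernel_neg]
  congr 1
  ring

end Kernel

/-! ### Green function and Cauchy problem -/

section Solutions

variable {p : ℝ → ℝ → ℝ}

lemma SolvesFreeEvolution.congr {u v : ℝ → ℝ → ℝ} (hu : SolvesFreeEvolution p u)
    (h : ∀ t, 0 < t → v t = u t) : SolvesFreeEvolution p v where
  contDiff t ht := h t ht ▸ hu.contDiff t ht
  integrable t ht y := by
    rw [h t ht]
    exact hu.integrable t ht y
  equation t ht y := by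
    rw [h t ht]
    refine (hu.equation t ht y).congr_of_eventuallyEq ?_
    filter_upwards [Ioi_mem_nhds ht] with s hs
    rw [h s hs]

lemma IsHeatFunction.comp_sub_right {H H₁ H₂ : ℝ → ℝ → ℝ} (h : IsHeatFunction H H₁ H₂) (a : ℝ) :
    IsHeatFunction (fun t x => H t (x - a)) (fun t x => H₁ t (x - a))
      (fun t x => H₂ t (x - a)) where
  hasDerivAt t ht x := (h.hasDerivAt t ht (x - a)).comp_sub_const x a
  hasDerivAt' t ht x := (h.hasDerivAt' t ht (x - a)).comp_sub_const x a
  continuous t ht := (h.continuous t ht).comp (continuous_sub_right a)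
  time t ht x := h.time t ht (x - a)
  bound a' b ha := by
    obtain ⟨C, hC⟩ := h.bound a' b ha
    exact ⟨C, fun t ht x => hC t ht (x - a)⟩

lemma IsJumpDensity.solvesFreeEvolution_jumpKernel (hp : IsJumpDensity p) (x : ℝ) :
    SolvesFreeEvolution p fun t y => Real.exp t * jumpKernel p t x y := by
  refine ((isHeatFunction_heatKernel.comp_sub_right x).solvesFreeEvolution hp).congr fun t _ => ?_
  ext y
  rw [exp_mul_jumpKernel, jumpEvolution, jumpEvolution, convMeasure, convMeasure]
  simp_rw [sub_right_comm]

lemma tendsto_exp_nhdsGT_zero : Tendsto Real.exp (𝓝[>] 0) (𝓝 1) := by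
  simpa using (Real.continuous_exp.tendsto 0).mono_left nhdsWithin_le_nhds

lemma IsJumpDensity.hasInitialDirac_jumpKernel (hp : IsJumpDensity p) (x : ℝ) :
    HasInitialDirac (fun t y => Real.exp t * jumpKernel p t x y) x := by
  refine ⟨fun t ht => (hp.integrable_jumpKernel ht x).const_mul _, fun f => ?_⟩
  have h := tendsto_exp_nhdsGT_zero.mul (hp.tendsto_semigroup f.continuous f.norm_coe_le_norm x)
  rw [one_mul] at h
  refine h.congr' ?_
  filter_upwards [self_mem_nhdsWithin] with t ht
  simp_rw [mul_assoc]
  rw [integral_const_mul,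
    hp.semigroup_eq_integral_jumpKernel ht f.continuous f.norm_coe_le_norm x]

/-- An expectation evaluates `f` at `x + w`, a convolution at `x - w`. Reversed jumps reconcile the
two, which is why the adjoint semigroup solves the equation for `p`. -/
lemma IsJumpDensity.exp_mul_semigroup_adj (hp : IsJumpDensity p) {f : ℝ → ℝ} (hf : Continuous f)
    {C : ℝ} (hC : ∀ x, |f x| ≤ C) {t : ℝ} (ht : 0 < t) (x : ℝ) :
    Real.exp t * semigroup (JumpBM.adj p) t f x = jumpEvolution p (heatConv heatKernel f) t x := by
  have hh : heatConv heatKernel f t = heatSemigroup t f :=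
    funext fun x => (heatSemigroup_eq_integral_heatKernel ht hf x).symm
  have hc : Continuous (heatSemigroup t f) :=
    (continuous_heatSemigroup hf hC).comp (f := fun x => (t, x)) (by fun_prop)
  rw [jumpEvolution, hh, hp.adj.semigroup_eq_integral_integral ht.le hf hC]
  exact congrArg _ (hp.adj.convMeasure_totalJumpLaw_adj ht.le hc (abs_heatSemigroup_le hC t) x).symm

lemma IsJumpDensity.isSolutionFrom (hp : IsJumpDensity p) (ρ₀ : ℝ →ᵇ ℝ) :
    IsSolutionFrom p ρ₀ fun t x => Real.exp t * semigroup (JumpBM.adj p) t ρ₀ x where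
  solves := ((isHeatFunction_heatConv ρ₀.continuous ρ₀.norm_coe_le_norm).solvesFreeEvolution
    hp).congr fun _ ht => funext fun x =>
      hp.exp_mul_semigroup_adj ρ₀.continuous ρ₀.norm_coe_le_norm ht x
  initial := by
    ext x
    rw [Real.exp_zero, one_mul, hp.adj.semigroup_zero]
  continuousOn := by
    have h := hp.adj.continuousOn_semigroup ρ₀.continuous ρ₀.norm_coe_le_norm
    fun_prop
  bounded T := by
    refine ⟨Real.exp T * ‖ρ₀‖, fun t ht hT x => ?_⟩
    rw [abs_mul, Real.abs_exp]
    gcongr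
    exact hp.adj.abs_semigroup_le ht ρ₀.norm_coe_le_norm x

end Solutions

end JumpBM

end
theorem mainTheorem8 (p : ℝ → ℝ → ℝ) (hp : JumpBM.IsJumpDensity p) :
    JumpBM.IsMarkovSemigroupWithGenerator (JumpBM.transitionLaw p) (JumpBM.generator p) ∧
    JumpBM.IsMarkovSemigroupWithGenerator (JumpBM.transitionLaw (JumpBM.adj p))
      (JumpBM.generator (JumpBM.adj p)) ∧
    (∀ (Ω : Type*) [MeasurableSpace Ω] (P : Measure Ω) (x : ℝ) (B : ℝ≥0 → Ω → ℝ)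
      (N : ℝ≥0 → Ω → ℕ) (Z : ℕ → Ω → ℝ) (X : ℝ≥0 → Ω → ℝ),
      (JumpBM.IsBrownianMotionWithJumps p x B N Z X P →
        ∀ (t : ℝ≥0) (f : ℝ →ᵇ ℝ), ∫ w, f (X t w) ∂P = JumpBM.semigroup p t f x) ∧
      (JumpBM.IsBrownianMotionWithJumps (JumpBM.adj p) x B N Z X P →
        ∀ (t : ℝ≥0) (f : ℝ →ᵇ ℝ),
          ∫ w, f (X t w) ∂P = JumpBM.semigroup (JumpBM.adj p) t f x)) ∧
    ∃ k kstar T Tstar : ℝ → ℝ → ℝ → ℝ,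
      JumpBM.IsSmoothKernel p k ∧
      JumpBM.IsSmoothKernel (JumpBM.adj p) kstar ∧
      (∀ t x y, T t x y = Real.exp t * k t x y) ∧
      (∀ t y x, Tstar t y x = Real.exp t * kstar t y x) ∧
      (∀ t, 0 < t → ∀ x y, T t x y = Tstar t y x) ∧
      (∀ x, JumpBM.SolvesFreeEvolution p (fun t y => Tstar t y x) ∧
        JumpBM.HasInitialDirac (fun t y => Tstar t y x) x) ∧
      ∀ ρ₀ : ℝ →ᵇ ℝ,
        (∃ ρ : ℝ → ℝ → ℝ, JumpBM.IsSolutionFrom p ρ₀ ρ) ∧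
        ∀ ρ : ℝ → ℝ → ℝ, JumpBM.IsSolutionFrom p ρ₀ ρ →
          (∀ t, 0 < t → ∀ x, ρ t x = ∫ y, Tstar t x y * ρ₀ y) ∧
          (∀ t, 0 ≤ t → ∀ x, |ρ t x| ≤ Real.exp t * ‖ρ₀‖) := by
  have hsymm : ∀ t, 0 < t → ∀ x y, Real.exp t * JumpBM.jumpKernel p t x y =
      Real.exp t * JumpBM.jumpKernel (JumpBM.adj p) t y x := fun t ht x y => by
    rw [hp.jumpKernel_adj ht]
  refine ⟨hp.isMarkovSemigroupWithGenerator, hp.adj.isMarkovSemigroupWithGenerator,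
    fun Ω _ P x B N Z X => ⟨fun h t f => hp.integral_process h t f,
      fun h t f => hp.adj.integral_process h t f⟩,
    JumpBM.jumpKernel p, JumpBM.jumpKernel (JumpBM.adj p),
    fun t x y => Real.exp t * JumpBM.jumpKernel p t x y,
    fun t y x => Real.exp t * JumpBM.jumpKernel (JumpBM.adj p) t y x,
    hp.isSmoothKernel_jumpKernel, hp.adj.isSmoothKernel_jumpKernel, fun _ _ _ => rfl,
    fun _ _ _ => rfl, hsymm, fun x => ⟨?_, ?_, fun f => ?_⟩, fun ρ₀ => ⟨⟨_, hp.isSolutionFrom ρ₀⟩,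
      fun ρ hρ => ⟨fun t ht x => ?_, fun t ht x => ?_⟩⟩⟩
  · exact (hp.solvesFreeEvolution_jumpKernel x).congr fun t ht => funext fun y =>
      (hsymm t ht x y).symm
  · intro t ht
    simp_rw [← hsymm t ht x]
    exact (hp.hasInitialDirac_jumpKernel x).1 t ht
  · refine ((hp.hasInitialDirac_jumpKernel x).2 f).congr' ?_
    filter_upwards [self_mem_nhdsWithin] with t ht
    simp_rw [hsymm t ht x]
  -- Uniqueness replaces an arbitrary solution by the explicit one, for which the kernel
  -- representation is known.
  · rw [hρ.unique hp (hp.isSolutionFrom ρ₀) ht.le, hp.adj.semigroup_eq_integral_jumpKernel ht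
      ρ₀.continuous ρ₀.norm_coe_le_norm, ← integral_const_mul]
    simp_rw [mul_assoc]
  · rw [hρ.unique hp (hp.isSolutionFrom ρ₀) ht, abs_mul, Real.abs_exp]
    gcongr
    exact hp.adj.abs_semigroup_le ht ρ₀.norm_coe_le_norm x
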